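/- Let $\gamma\in[-1,1]$. For each $N\ge1$ let $(X_{ij})_{i,j=1}^N$ be a real Gaussian elliptic matrix of parameter $\gamma$: the random elements $X_{ii}$ ($1\le i\le N$) and $(X_{ij},X_{ji})$ ($1\le i<j\le N$) are independent; the pairs $(X_{ij},X_{ji})$, $i<j$, are i.i.d. centered (possibly degenerate) real Gaussian vectors with $\mathbb E X_{ij}^2=\mathbb E X_{ji}^2=1$ and $\mathbb E X_{ij}X_{ji}=\gamma$; and the $X_{ii}$ are i.i.d. centered (possibly degenerate) real Gaussian variables with $\mathbb E X_{ii}^2=1+\gamma$. Let $X=X_N=\frac1{\sqrt N}(X_{ij})_{i,j=1}^N$ be the normalized matrix, let $\mathrm{Tr}$ be the unnormalized trace, and let $\mathrm{Cov}(\xi,\eta)=\mathbb E(\xi\eta)-\mathbb E(\xi)\,\mathbb E(\eta)$. Then for all integers $p,q\ge1$ the traces below are square-integrable and $$\lim_{N\to\infty}\mathrm{Cov}\big(\mathrm{Tr}\,X^p,\mathrm{Tr}\,X^q\big)=\lim_{N\to\infty}\mathrm{Cov}\big(\mathrm{Tr}\,X^p,\mathrm{Tr}\,(X^{T})^q\big)=\sum_{a=1}^{\min\{p,q\}}a\,\gamma^{\frac{p+q}2-a}(\gamma^a+1)\binom{p}{\frac{p-a}2}\binom{q}{\frac{q-a}2},$$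 where a term is zero unless $p-a$ and $q-a$ are both even, and where $\gamma^0=1$ also for $\gamma=0$; and $$\lim_{N\to\infty}\mathrm{Cov}\big(\mathrm{Tr}\,(XX^{T})^p,\mathrm{Tr}\,(XX^{T})^q\big)=\sum_{a=1}^{\min\{p,q\}}2a\,(\gamma^{2a}+1)\binom{2p}{p-a}\binom{2q}{q-a}.$$ -/

import Mathlib

open MeasureTheory ProbabilityTheory Filter Topology
open scoped Matrix

/-- A real `N × N` Gaussian elliptic matrix of parameter `γ` (not normalized), as a random matrix
on the probability space `(Ω, P)`.

Independence is that of the family `(X i j, X j i)`, `i ≤ j`; for `i = j` this is `(X i i, X i i)`,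
which generates the same σ-algebra as `X i i`. The Gaussian pairs `(X i j, X j i)`, `i < j`, are
identically distributed, as a Gaussian law is determined by its mean and covariance; the same
holds for the diagonal entries. Gaussian laws may be degenerate. -/
structure IsRealGaussianElliptic {Ω : Type*} [MeasurableSpace Ω] {N : ℕ} (γ : ℝ)
    (X : Ω → Matrix (Fin N) (Fin N) ℝ) (P : Measure Ω) : Prop where
  indep : iIndepFun (fun (e : {e : Fin N × Fin N // e.1 ≤ e.2}) (ω : Ω) ↦
    (X ω e.1.1 e.1.2, X ω e.1.2 e.1.1)) P
  gaussian_offDiag : ∀ i j, i < j → HasGaussianLaw (fun ω ↦ (X ω i j, X ω j i)) P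
  gaussian_diag : ∀ i, HasGaussianLaw (fun ω ↦ X ω i i) P
  centered : ∀ i j, ∫ ω, X ω i j ∂P = 0
  sq_offDiag : ∀ i j, i ≠ j → ∫ ω, X ω i j ^ 2 ∂P = 1
  mul_offDiag : ∀ i j, i ≠ j → ∫ ω, X ω i j * X ω j i ∂P = γ
  sq_diag : ∀ i, ∫ ω, X ω i i ^ 2 ∂P = 1 + γ

/-- The normalized matrix `N^{-1/2} M`. -/
noncomputable def normalizedMatrix {N : ℕ} (M : Matrix (Fin N) (Fin N) ℝ) :
    Matrix (Fin N) (Fin N) ℝ :=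
  (√(N : ℝ))⁻¹ • M

/-- `lim_{N → ∞} Cov(ξ_N, η_N) = c`, for square-integrable random variables `ξ_N`, `η_N` on
the probability space `(Ω N, P N)`. Square-integrability is part of the claim, so that every
covariance is a genuine one. -/
def HasLimitCovariance {Ω : ℕ → Type*} [∀ N, MeasurableSpace (Ω N)] (P : ∀ N, Measure (Ω N))
    (ξ η : ∀ N, Ω N → ℝ) (c : ℝ) : Prop :=
  (∀ N, MemLp (ξ N) 2 (P N)) ∧ (∀ N, MemLp (η N) 2 (P N)) ∧
    Tendsto (fun N ↦ covariance (ξ N) (η N) (P N)) atTop (𝓝 c)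

/-- `∑ a γ^{(p+q)/2-a} (γ^a + 1) C(p, (p-a)/2) C(q, (q-a)/2)` over `1 ≤ a ≤ min p q` of the same
parity as both `p` and `q`: a binomial coefficient with a non-integral lower entry is zero. -/
noncomputable def purePowerLimit (γ : ℝ) (p q : ℕ) : ℝ :=
  ∑ a ∈ (Finset.Icc 1 (min p q)).filter (fun a ↦ Even (p - a) ∧ Even (q - a)),
    (a : ℝ) * γ ^ ((p + q) / 2 - a) * (γ ^ a + 1) *
      (p.choose ((p - a) / 2) : ℝ) * (q.choose ((q - a) / 2) : ℝ)

/-- `∑_{a=1}^{min p q} 2 a (γ^{2a} + 1) C(2p, p-a) C(2q, q-a)`. -/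
noncomputable def alternatingLimit (γ : ℝ) (p q : ℕ) : ℝ :=
  ∑ a ∈ Finset.Icc 1 (min p q),
    2 * (a : ℝ) * (γ ^ (2 * a) + 1) *
      ((2 * p).choose (p - a) : ℝ) * ((2 * q).choose (q - a) : ℝ)

/-! Every `γ ∈ [-1, 1]` is `2ab` with `a² + b² = 1`, and the matrix then has the law of `aG + bGᵀ`
for a matrix `G` of independent standard Gaussians. The traces become polynomials in Gaussian
variables, and all the covariances can be computed by integration by parts.

Contracting the first letter of a word in `X` and `Xᵀ` with another letter either splits the word in
two, reconnects it with a piece transposed, or welds it to another word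
(`EllipticModel.schwingerDyson`). For centered traces every resulting term has total length smaller
by two, and no power of `N` grows (`EllipticModel.moment_cons_cons`). Induction on length therefore
bounds all mixed moments (`EllipticModel.evBdd_of_length_le`), after which the terms carrying `N⁻¹`
drop out. In the limit, means are governed by splittings alone. Covariances are governed by
splittings and by weldings of the two words.

Powers of `X` and of `XXᵀ` are treated together as words with letters in progression of step `δ`.
Contracted letters weigh `α` inside such a word; welding two of them gives both a continued word
(weight `α`) and a flipped one (weight `β`). Here `(α, β)` is `(γ, 1)` for `δ = 0` and `(1, γ)` for
`δ = 1`. The limiting means are ballot numbers, or pairs of ballot paths for flipped words. Path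
decompositions show that the binomial sum `limitCov` obeys the limiting recursion
(`limitCov_succ_succ`), and `EllipticModel.tendsto_moment_progWord` matches the two. -/

/-! ### Lattice paths and the recursion for the limit covariance -/

/-- Weighted ballot numbers: paths in `ℕ` from `0` to `t` with `n` steps `±1`, every down-step
having weight `α`. -/
def ballot (α : ℝ) : ℕ → ℕ → ℝ
  | 0, 0 => 1
  | 0, _ + 1 => 0
  | n + 1, 0 => α * ballot α n 1
  | n + 1, t + 1 => ballot α n t + α * ballot α n (t + 2)

/-- Weighted binomial coefficients `α ^ ((n - t) / 2) * C(n, (n - t) / 2)`, given by the Pascal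
recursion on the folded line. -/
def folded (α : ℝ) : ℕ → ℕ → ℝ
  | 0, 0 => 1
  | 0, _ + 1 => 0
  | n + 1, 0 => 2 * α * folded α n 1
  | n + 1, t + 1 => folded α n t + α * folded α n (t + 2)

section Combinatorics

variable (α β : ℝ)

lemma ballot_of_lt (n t : ℕ) (h : n < t) : ballot α n t = 0 := by
  induction n generalizing t with
  | zero => cases t with
    | zero => omega
    | succ t => rfl
  | succ n ih => cases t with
    | zero => omega
    | succ t => simp [ballot, ih t (by omega), ih (t + 2) (by omega)]

lemma folded_of_lt (n t : ℕ) (h : n < t) : folded α n t = 0 := by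
  induction n generalizing t with
  | zero => cases t with
    | zero => omega
    | succ t => rfl
  | succ n ih => cases t with
    | zero => omega
    | succ t => simp [folded, ih t (by omega), ih (t + 2) (by omega)]

lemma ballot_of_odd (n t : ℕ) (h : Odd (n + t)) : ballot α n t = 0 := by
  induction n generalizing t with
  | zero => cases t with
    | zero => simp at h
    | succ t => rfl
  | succ n ih => cases t with
    | zero => simp [ballot, ih 1 (by simpa using h)]
    | succ t =>
      have h1 : Odd (n + t) := by rw [Nat.odd_iff] at *; omega
      have h2 : Odd (n + (t + 2)) := by rw [Nat.odd_iff] at *; omega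
      simp [ballot, ih _ h1, ih _ h2]

lemma folded_of_odd (n t : ℕ) (h : Odd (n + t)) : folded α n t = 0 := by
  induction n generalizing t with
  | zero => cases t with
    | zero => simp at h
    | succ t => rfl
  | succ n ih => cases t with
    | zero => simp [folded, ih 1 (by simpa using h)]
    | succ t =>
      have h1 : Odd (n + t) := by rw [Nat.odd_iff] at *; omega
      have h2 : Odd (n + (t + 2)) := by rw [Nat.odd_iff] at *; omega
      simp [folded, ih _ h1, ih _ h2]

/-- On the whole line these weights satisfy `f(n, -t) = α ^ t * f(n, t)`. Folding at `0` therefore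
produces the factor `2 * α` in the recursion. -/
lemma folded_eq_choose (n t k : ℕ) (h : n = t + 2 * k) :
    folded α n t = α ^ k * (n.choose k : ℝ) := by
  induction n generalizing t k with
  | zero =>
    obtain rfl : t = 0 := by omega
    obtain rfl : k = 0 := by omega
    simp [folded]
  | succ n ih => cases t with
    | zero =>
      obtain ⟨k, rfl⟩ : ∃ k', k = k' + 1 := ⟨k - 1, by omega⟩
      obtain rfl : n = 2 * k + 1 := by omega
      rw [folded, ih 1 k (by omega), Nat.choose_succ_succ, ← Nat.choose_symm_half k]
      push_cast
      ring
    | succ t => cases k with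
      | zero =>
        rw [folded, ih t 0 (by omega), folded_of_lt α n (t + 2) (by omega)]
        simp
      | succ k =>
        rw [folded, ih t (k + 1) (by omega), ih (t + 2) k (by omega), Nat.choose_succ_succ]
        push_cast
        ring

/-- The ratio of neighbouring binomial coefficients with denominators cleared, so that it needs no
condition on parity or range. -/
lemma folded_ratio (n t : ℕ) :
    ((n : ℝ) - t) * folded α n t = α * (n + t + 2) * folded α n (t + 2) := by
  induction n generalizing t with
  | zero => cases t <;> simp [folded]
  | succ n ih => cases t with
    | zero =>
      have := ih 1
      simp only [folded]
      push_cast at this ⊢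
      linear_combination α * this
    | succ t =>
      have h1 := ih t
      have h2 := ih (t + 2)
      simp only [folded]
      push_cast at h1 h2 ⊢
      linear_combination h1 + α * h2

/-- The ballot theorem: a fraction `(t + 1) / (n + 1)` of the free paths remains. It absorbs the
factor `a` of the limit formula. -/
lemma mul_folded (n t : ℕ) :
    ((t : ℝ) + 1) * folded α (n + 1) (t + 1) = (n + 1) * ballot α n t := by
  induction n generalizing t with
  | zero => cases t <;> simp [folded, ballot]
  | succ n ih =>
    have hn : (n : ℝ) + 1 ≠ 0 := by positivity
    apply mul_left_cancel₀ hn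
    cases t with
    | zero =>
      have h1 := ih 1
      have h2 := folded_ratio α (n + 1) 0
      rw [folded, ballot]
      push_cast at h1 h2 ⊢
      linear_combination h2 + α * (n + 2) * h1
    | succ t =>
      have h1 := ih t
      have h2 := ih (t + 2)
      have h3 := folded_ratio α (n + 1) (t + 1)
      rw [folded, ballot]
      push_cast at h1 h2 h3 ⊢
      linear_combination h3 + (n + 2) * h1 + (n + 2) * α * h2

lemma sum_range_reflect_sub (f : ℕ → ℕ → ℝ) (n : ℕ) :
    ∑ i ∈ Finset.range n, f (n - 1 - i) i = ∑ i ∈ Finset.range n, f i (n - 1 - i) := by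
  rw [← Finset.sum_range_reflect]
  refine Finset.sum_congr rfl fun i hi ↦ ?_
  rw [Finset.mem_range] at hi
  congr 1
  omega

lemma sum_range_eq_sum_range {f : ℕ → ℝ} {m n : ℕ} (hm : ∀ t ≥ m, f t = 0)
    (hn : ∀ t ≥ n, f t = 0) : ∑ t ∈ Finset.range m, f t = ∑ t ∈ Finset.range n, f t := by
  rcases le_total m n with h | h
  · exact Finset.sum_subset (Finset.range_subset_range.2 h) fun t _ ht ↦ hm t (by simpa using ht)
  · exact (Finset.sum_subset (Finset.range_subset_range.2 h)
      fun t _ ht ↦ hn t (by simpa using ht)).symm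

lemma sum_range_mul_succ (f g : ℕ → ℝ) (n : ℕ) :
    ∑ i ∈ Finset.range (n + 1), f i * g (n + 1 - 1 - i) =
      f n * g 0 + ∑ i ∈ Finset.range n, f i * g (n - 1 - i + 1) := by
  rw [Finset.sum_range_succ, add_comm]
  congr 1
  · simp
  · refine Finset.sum_congr rfl fun i hi ↦ ?_
    rw [Finset.mem_range] at hi
    congr 2
    omega

/-- Cut a path ending at `t + 1` at its last visit to `0`, which is followed by an up-step. -/
lemma sum_ballot_zero_mul_ballot (n t : ℕ) :
    ∑ i ∈ Finset.range n, ballot α i 0 * ballot α (n - 1 - i) t = ballot α n (t + 1) := by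
  induction n generalizing t with
  | zero => simp [ballot]
  | succ n ih =>
    rw [sum_range_mul_succ (fun i ↦ ballot α i 0) (fun j ↦ ballot α j t)]
    cases t with
    | zero =>
      simp only [ballot, mul_left_comm _ α, ← Finset.mul_sum, ih]
      simp
    | succ t =>
      simp only [ballot, mul_add, mul_left_comm _ α, ← Finset.mul_sum, Finset.sum_add_distrib, ih]
      simp

lemma sum_ballot_mul_ballot_zero (n t : ℕ) :
    ∑ i ∈ Finset.range n, ballot α i t * ballot α (n - 1 - i) 0 = ballot α n (t + 1) := by
  rw [← sum_ballot_zero_mul_ballot,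
    ← sum_range_reflect_sub (fun i j ↦ ballot α i 0 * ballot α j t)]
  simp only [mul_comm]

/-- First-return decomposition of a free walk on the integers. The excursion lies above or below
`0`, whence `2 * α`; a walk that never returns is a ballot path after its first step. -/
lemma folded_succ_eq (n t : ℕ) : folded α (n + 1) t =
    2 * α * ∑ i ∈ Finset.range n, ballot α i 0 * folded α (n - 1 - i) t +
      if t = 0 then 0 else ballot α n (t - 1) := by
  induction n generalizing t with
  | zero => rcases t with _ | _ | t <;> simp [ballot, folded]
  | succ n ih =>
    rw [sum_range_mul_succ (fun i ↦ ballot α i 0) (fun j ↦ folded α j t), folded.eq_def]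
    rcases t with _ | _ | t
    · simp only [ih]
      simp only [folded, mul_left_comm _ (2 * α), ← Finset.mul_sum, one_ne_zero, if_false, if_true,
        Nat.sub_self]
      ring
    · simp only [ih]
      simp only [folded, mul_add, mul_left_comm _ α, ← Finset.mul_sum, Finset.sum_add_distrib]
      simp [ballot]
      ring
    · simp only [ih]
      simp only [folded, mul_add, mul_left_comm _ α, ← Finset.mul_sum, Finset.sum_add_distrib]
      simp [ballot]
      ring

/-- Pairs of paths with a common end point `t`, weighted by `β ^ t`. -/
noncomputable def ballotPair (n k : ℕ) : ℝ :=
  ∑ t ∈ Finset.range (n + 1), β ^ t * (ballot α n t * ballot α k t)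

lemma ballotPair_eq_sum {n T : ℕ} (k : ℕ) (h : n < T) :
    ballotPair α β n k = ∑ t ∈ Finset.range T, β ^ t * (ballot α n t * ballot α k t) := by
  refine Finset.sum_subset (by simpa using h) fun t _ ht ↦ ?_
  rw [ballot_of_lt α n t (by simpa using ht)]
  simp

lemma ballotPair_comm (n k : ℕ) : ballotPair α β n k = ballotPair α β k n := by
  rw [ballotPair_eq_sum α β k (show n < n + k + 1 by omega),
    ballotPair_eq_sum α β n (show k < n + k + 1 by omega)]
  simp only [mul_comm]

@[simp] lemma ballotPair_zero_left (k : ℕ) : ballotPair α β 0 k = ballot α k 0 := by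
  simp [ballotPair, ballot]

@[simp] lemma ballotPair_zero_right (n : ℕ) : ballotPair α β n 0 = ballot α n 0 := by
  rw [ballotPair_comm, ballotPair_zero_left]

lemma ballotPair_of_odd (n k : ℕ) (h : Odd (n + k)) : ballotPair α β n k = 0 := by
  refine Finset.sum_eq_zero fun t _ ↦ ?_
  rcases Nat.even_or_odd (n + t) with h1 | h1
  · rw [ballot_of_odd α k t (by rw [Nat.odd_iff, Nat.even_iff] at *; omega)]; simp
  · rw [ballot_of_odd α n t h1]; simp

lemma ballotPair_succ_eq_sum (n k : ℕ) : ballotPair α β (n + 1) k =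
    α * (∑ t ∈ Finset.range (n + 2), β ^ t * (ballot α n (t + 1) * ballot α k t)) +
    β * ∑ t ∈ Finset.range (n + 1), β ^ t * (ballot α n t * ballot α k (t + 1)) := by
  rw [ballotPair, Finset.sum_range_succ', Finset.sum_range_succ' _ (n + 1), Finset.mul_sum,
    mul_add, Finset.mul_sum, add_right_comm, ← Finset.sum_add_distrib]
  congr 1
  · refine Finset.sum_congr rfl fun t _ ↦ ?_
    simp only [ballot]
    ring
  · simp [ballot]
    ring

/-- Remove the last step of the first path and cut one path at its last passage. This is the
contraction recursion of a two-block word: the first letter is paired inside its own block, or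
across with weight `β`. -/
lemma ballotPair_succ_left (n k : ℕ) : ballotPair α β (n + 1) k =
    α * ∑ i ∈ Finset.range n, ballot α i 0 * ballotPair α β (n - 1 - i) k +
    β * ∑ i ∈ Finset.range k, ballotPair α β n i * ballot α (k - 1 - i) 0 := by
  rw [ballotPair_succ_eq_sum]
  congr 2
  · simp only [← sum_ballot_zero_mul_ballot, Finset.sum_mul, Finset.mul_sum]
    rw [Finset.sum_comm]
    refine Finset.sum_congr rfl fun i _ ↦ ?_
    rw [ballotPair_eq_sum α β k (show n - 1 - i < n + 2 by omega), Finset.mul_sum]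
    exact Finset.sum_congr rfl fun t _ ↦ by ring
  · simp only [← sum_ballot_mul_ballot_zero, Finset.mul_sum]
    rw [Finset.sum_comm]
    refine Finset.sum_congr rfl fun i _ ↦ ?_
    rw [ballotPair, Finset.sum_mul]
    exact Finset.sum_congr rfl fun t _ ↦ by ring

/-- Reversing the second path turns its up-steps into down-steps, which costs exactly `α ^ t`, and
the two paths concatenate to one closed path. The induction moves one step at a time from the first
path to the second. -/
lemma ballotPair_self (n k : ℕ) : ballotPair α α n k = ballot α (n + k) 0 := by
  induction n generalizing k with
  | zero => simp
  | succ n ih =>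
    rw [show n + 1 + k = n + (k + 1) by ring, ← ih, ballotPair_comm α α n, ballotPair_succ_eq_sum,
      ballotPair_succ_eq_sum, add_comm]
    congr 2
    · simp only [mul_comm (ballot α n _)]
      refine sum_range_eq_sum_range (fun t ht ↦ ?_) fun t ht ↦ ?_
      · rw [ballot_of_lt α n t (by omega)]; simp
      · rw [ballot_of_lt α k (t + 1) (by omega)]; simp
    · simp only [mul_comm (ballot α n _)]
      refine sum_range_eq_sum_range (fun t ht ↦ ?_) fun t ht ↦ ?_
      · rw [ballot_of_lt α n (t + 1) (by omega)]; simp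
      · rw [ballot_of_lt α k t (by omega)]; simp

/-- The limit covariance of the traces of two words of lengths `p` and `q`. -/
noncomputable def limitCov (p q : ℕ) : ℝ :=
  ∑ t ∈ Finset.range q, ((t : ℝ) + 1) * (α ^ (t + 1) + β ^ (t + 1)) *
    (folded α p (t + 1) * folded α q (t + 1))

lemma limitCov_zero_left (q : ℕ) : limitCov α β 0 q = 0 := by
  simp [limitCov, folded]

lemma limitCov_succ_succ (p q : ℕ) : limitCov α β (p + 1) (q + 1) =
    2 * α * ∑ i ∈ Finset.range p, ballot α i 0 * limitCov α β (p - 1 - i) (q + 1) +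
      (q + 1) * (α * ballot α (p + q) 0 + β * ballotPair α β p q) := by
  -- Termwise form: `folded_succ_eq` decomposes the factor of length `p + 1`, and in its
  -- non-returning part `mul_folded` trades `t + 1` for `q + 1`. Summing over `t` then yields pairs
  -- of paths, with `ballotPair_self` for the weight `α`.
  have h (t : ℕ) : ((t : ℝ) + 1) * (α ^ (t + 1) + β ^ (t + 1)) *
      (folded α (p + 1) (t + 1) * folded α (q + 1) (t + 1)) =
      2 * α * ∑ i ∈ Finset.range p, ballot α i 0 * (((t : ℝ) + 1) * (α ^ (t + 1) + β ^ (t + 1)) *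
      (folded α (p - 1 - i) (t + 1) * folded α (q + 1) (t + 1))) +
      (q + 1) * (α * (α ^ t * (ballot α q t * ballot α p t)) +
        β * (β ^ t * (ballot α q t * ballot α p t))) := by
    have h1 := mul_folded α q t
    have h2 : ∑ i ∈ Finset.range p, ballot α i 0 * (((t : ℝ) + 1) * (α ^ (t + 1) + β ^ (t + 1)) *
      (folded α (p - 1 - i) (t + 1) * folded α (q + 1) (t + 1))) =
      (((t : ℝ) + 1) * (α ^ (t + 1) + β ^ (t + 1)) * folded α (q + 1) (t + 1)) *
      ∑ i ∈ Finset.range p, ballot α i 0 * folded α (p - 1 - i) (t + 1) := by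
      rw [Finset.mul_sum]
      exact Finset.sum_congr rfl fun i _ ↦ by ring
    rw [h2, folded_succ_eq α p]
    simp only [Nat.add_eq_zero_iff, one_ne_zero, and_false, if_false, Nat.add_sub_cancel]
    linear_combination (α ^ (t + 1) + β ^ (t + 1)) * ballot α p t * h1
  rw [limitCov, Finset.sum_congr rfl fun t _ ↦ h t, Finset.sum_add_distrib, ← Finset.mul_sum,
    ← Finset.mul_sum, Finset.sum_add_distrib, ← Finset.mul_sum, ← Finset.mul_sum,
    ballotPair_comm α β p, ballotPair, ← ballotPair_self, ballotPair_comm, ballotPair,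
    Finset.sum_comm]
  simp only [← Finset.mul_sum, limitCov]

end Combinatorics

/-! ### The algebraic model and its Schwinger–Dyson equation -/

/-- The weight of a pair of letters: `γ` for equal letters, `1` for different ones. -/
noncomputable def pairWeight (γ : ℝ) (x : ZMod 2) : ℝ := if x = 0 then γ else 1

/-- An algebraic model of the normalized elliptic matrix: `E` is the expectation, `A 0` is the
matrix and `A 1` its transpose, and `ibp` is Gaussian integration by parts. -/
structure EllipticModel (γ : ℝ) (N : ℕ) (R : Type*) [CommRing R] [Algebra ℝ R] where
  E : R →ₗ[ℝ] ℝ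
  E_one : E 1 = 1
  A : ZMod 2 → Matrix (Fin N) (Fin N) R
  A_transpose : ∀ ε, (A ε)ᵀ = A (ε + 1)
  D : ZMod 2 → Fin N → Fin N → Derivation ℝ R R
  ibp : ∀ ε i j p, E (A ε i j * p) = E (D ε i j p)
  -- Entries of two equal letters have covariance `1` at equal positions and `γ` at transposed ones;
  -- for different letters the roles are exchanged.
  D_A : ∀ ε i j ε', (A ε').map (D ε i j) = (N : ℝ)⁻¹ •
    (pairWeight γ (ε + ε' + 1) • Matrix.single i j 1 + pairWeight γ (ε + ε') • Matrix.single j i 1)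

/-- The word whose matrix is the transpose of that of `w`. -/
def wordTranspose (w : List (ZMod 2)) : List (ZMod 2) := (w.map (· + 1)).reverse

@[simp] lemma length_wordTranspose (w : List (ZMod 2)) :
    (wordTranspose w).length = w.length := by
  simp [wordTranspose]

lemma mul_single_mul_apply {n R : Type*} [Fintype n] [DecidableEq n] [CommRing R]
    (U V : Matrix n n R) (i j k l : n) :
    (U * Matrix.single i j (1 : R) * V) k l = U k i * V j l := by
  simp [Matrix.mul_apply, Matrix.single_apply, ite_and]

lemma trace_mul_single_mul {n R : Type*} [Fintype n] [DecidableEq n] [CommRing R]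
    (U V : Matrix n n R) (i j : n) :
    (U * Matrix.single i j (1 : R) * V).trace = (V * U) j i := by
  simp only [Matrix.trace, Matrix.diag, mul_single_mul_apply]
  rw [Matrix.mul_apply]
  exact Finset.sum_congr rfl fun k _ ↦ mul_comm _ _

namespace EllipticModel

variable {γ : ℝ} {N : ℕ} {R : Type*} [CommRing R] [Algebra ℝ R] (M : EllipticModel γ N R)

/-- The matrix of a word. -/
def word (w : List (ZMod 2)) : Matrix (Fin N) (Fin N) R := (w.map M.A).prod

/-- The trace of a word. -/
def tr (w : List (ZMod 2)) : R := (M.word w).trace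

@[simp] lemma word_nil : M.word [] = 1 := rfl

@[simp] lemma word_cons (ε : ZMod 2) (w) : M.word (ε :: w) = M.A ε * M.word w := by
  simp [word]

lemma word_append (u v) : M.word (u ++ v) = M.word u * M.word v := by
  simp [word]

lemma word_wordTranspose (w) : M.word (wordTranspose w) = (M.word w)ᵀ := by
  induction w with
  | nil => simp [wordTranspose]
  | cons ε w ih =>
    have : wordTranspose (ε :: w) = wordTranspose w ++ [ε + 1] := by simp [wordTranspose]
    rw [this, word_append, ih]
    simp [A_transpose]

@[simp] lemma tr_nil : M.tr [] = (N : R) := by simp [tr]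

lemma map_mul_derivation (d : Derivation ℝ R R) (A B : Matrix (Fin N) (Fin N) R) :
    (A * B).map d = A.map d * B + A * B.map d := by
  ext i j
  simp only [Matrix.map_apply, Matrix.mul_apply, Matrix.add_apply, map_sum, Derivation.leibniz,
    smul_eq_mul, ← Finset.sum_add_distrib]
  exact Finset.sum_congr rfl fun k _ ↦ by ring

lemma map_derivation_word (d : Derivation ℝ R R) (w : List (ZMod 2)) :
    (M.word w).map d = ∑ r ∈ Finset.range w.length,
      M.word (w.take r) * (M.A (w.getD r 0)).map d * M.word (w.drop (r + 1)) := by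
  induction w with
  | nil =>
    ext i j
    rcases eq_or_ne i j with rfl | h
    · simp
    · simp [h]
  | cons ε w ih =>
    rw [word_cons, map_mul_derivation, ih, List.length_cons, Finset.sum_range_succ', add_comm]
    congr 1
    · rw [Finset.mul_sum]
      simp [mul_assoc]
    · simp

/-- The derivation `F ↦ ∑ i j, (word w) j i * D ε i j F`. -/
def grad (ε : ZMod 2) (w : List (ZMod 2)) : Derivation ℝ R R :=
  ∑ i, ∑ j, M.word w j i • M.D ε i j

lemma grad_apply (ε : ZMod 2) (w : List (ZMod 2)) (F : R) :
    M.grad ε w F = ∑ i, ∑ j, M.word w j i * M.D ε i j F := by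
  have h (f : Fin N → Derivation ℝ R R) : (∑ i, f i) F = ∑ i, f i F := by
    rw [← Derivation.coeFnAddMonoidHom_apply, map_sum, Finset.sum_apply]
    rfl
  simp [grad, h]

/-- Differentiating letter `r` inserts a matrix unit. The unit `(j, i)` separates the two sides into
two traces, while `(i, j)` joins them into one trace with the right side transposed. -/
lemma sum_derivation_word (ε : ZMod 2) (w : List (ZMod 2)) :
    ∑ i, ∑ j, M.D ε i j (M.word w j i) = ∑ r ∈ Finset.range w.length, (N : ℝ)⁻¹ •
      (pairWeight γ (ε + w.getD r 0) • (M.tr (w.take r) * M.tr (w.drop (r + 1))) +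
       pairWeight γ (ε + w.getD r 0 + 1) •
        M.tr (w.take r ++ wordTranspose (w.drop (r + 1)))) := by
  have h (i j) : M.D ε i j (M.word w j i) = ((M.word w).map (M.D ε i j)) j i := rfl
  simp only [h, map_derivation_word, Matrix.sum_apply, D_A]
  rw [Finset.sum_congr rfl fun i _ ↦ Finset.sum_comm, Finset.sum_comm]
  refine Finset.sum_congr rfl fun r _ ↦ ?_
  simp only [Matrix.mul_smul, Matrix.smul_mul, mul_add, add_mul, Matrix.smul_apply,
    Matrix.add_apply, Finset.sum_add_distrib, ← Finset.smul_sum, smul_add, smul_smul]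
  rw [add_comm]
  congr 2
  · simp only [mul_single_mul_apply, tr, Matrix.trace, Matrix.diag, Finset.sum_mul_sum]
    exact Finset.sum_comm
  · simp only [mul_single_mul_apply]
    simp only [tr, word_append, word_wordTranspose, Matrix.trace, Matrix.diag, Matrix.mul_apply,
      Matrix.transpose_apply]
    exact Finset.sum_comm

/-- The cyclic word `w'` is opened at its letter `r` and welded to `w`, directly or transposed
according to the matrix unit. -/
lemma grad_tr (ε : ZMod 2) (w w' : List (ZMod 2)) :
    M.grad ε w (M.tr w') = ∑ r ∈ Finset.range w'.length, (N : ℝ)⁻¹ •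
      (pairWeight γ (ε + w'.getD r 0) • M.tr (w ++ (w'.drop (r + 1) ++ w'.take r)) +
       pairWeight γ (ε + w'.getD r 0 + 1) •
        M.tr (w ++ wordTranspose (w'.drop (r + 1) ++ w'.take r))) := by
  have h (i j) : M.D ε i j (M.tr w') = ((M.word w').map (M.D ε i j)).trace := by
    simp [tr, Matrix.trace]
  simp only [grad_apply, h, map_derivation_word, Matrix.trace_sum, D_A, Finset.mul_sum]
  rw [Finset.sum_congr rfl fun i _ ↦ Finset.sum_comm, Finset.sum_comm]
  refine Finset.sum_congr rfl fun r _ ↦ ?_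
  simp only [mul_add, add_mul, Matrix.smul_mul, Matrix.trace_smul,
    Matrix.trace_add, mul_smul_comm, Finset.sum_add_distrib, ← Finset.smul_sum, smul_add,
    trace_mul_single_mul, ← word_append]
  rw [add_comm]
  congr 3
  · simp only [tr, word_append, Matrix.trace, Matrix.diag, Matrix.mul_apply (M := M.word w)]
    exact Finset.sum_comm
  · rw [tr, M.word_append w, word_wordTranspose]
    simp only [Matrix.trace, Matrix.diag, Matrix.mul_apply (M := M.word w),
      Matrix.transpose_apply]
    exact Finset.sum_comm

/-- The Schwinger–Dyson equation. -/
lemma schwingerDyson (ε : ZMod 2) (w : List (ZMod 2)) (F : R) :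
    M.E (M.tr (ε :: w) * F) = ∑ r ∈ Finset.range w.length, (N : ℝ)⁻¹ *
      (pairWeight γ (ε + w.getD r 0) * M.E (M.tr (w.take r) * M.tr (w.drop (r + 1)) * F) +
       pairWeight γ (ε + w.getD r 0 + 1) *
        M.E (M.tr (w.take r ++ wordTranspose (w.drop (r + 1))) * F)) +
      M.E (M.grad ε w F) := by
  have h1 : M.tr (ε :: w) * F = ∑ i, ∑ j, M.A ε i j * (M.word w j i * F) := by
    simp [tr, Matrix.trace, Matrix.mul_apply, Finset.sum_mul, mul_assoc]
  have h2 : ∑ i, ∑ j, M.D ε i j (M.word w j i * F) =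
      (∑ i, ∑ j, M.D ε i j (M.word w j i)) * F + M.grad ε w F := by
    simp only [grad_apply, Finset.sum_mul, ← Finset.sum_add_distrib, Derivation.leibniz,
      smul_eq_mul]
    exact Finset.sum_congr rfl fun i _ ↦ Finset.sum_congr rfl fun j _ ↦ by ring
  rw [h1]
  simp only [map_sum, ibp]
  simp only [← map_sum]
  rw [h2, map_add, sum_derivation_word]
  simp [Finset.sum_mul, add_mul, mul_add]

end EllipticModel

/-! ### Exact recursions for means and centered moments -/

namespace EllipticModel

section Moments

variable {γ : ℝ} {N : ℕ} {R : Type*} [CommRing R] [Algebra ℝ R] (M : EllipticModel γ N R)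

/-- The normalized mean trace of a word. -/
noncomputable def mean (w : List (ZMod 2)) : ℝ := (N : ℝ)⁻¹ * M.E (M.tr w)

/-- The centered trace of a word. -/
noncomputable def ctr (w : List (ZMod 2)) : R := M.tr w - algebraMap ℝ R (M.E (M.tr w))

/-- The mixed moment of the centered traces of a list of words. -/
noncomputable def moment (L : List (List (ZMod 2))) : ℝ := M.E (L.map M.ctr).prod

lemma E_algebraMap (r : ℝ) : M.E (algebraMap ℝ R r) = r := by
  rw [Algebra.algebraMap_eq_smul_one, map_smul, E_one, smul_eq_mul, mul_one]

lemma E_algebraMap_mul (r : ℝ) (p : R) : M.E (algebraMap ℝ R r * p) = r * M.E p := by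
  rw [← Algebra.smul_def, map_smul, smul_eq_mul]

lemma E_ctr (w) : M.E (M.ctr w) = 0 := by
  rw [ctr, map_sub, E_algebraMap, sub_self]

lemma tr_eq (hN : N ≠ 0) (w) : M.tr w = algebraMap ℝ R (N * M.mean w) + M.ctr w := by
  have : (N : ℝ) ≠ 0 := by exact_mod_cast hN
  rw [mean, mul_inv_cancel_left₀ this, ctr, add_sub_cancel]

lemma ctr_nil : M.ctr [] = 0 := by
  have : (N : R) = algebraMap ℝ R N := by simp
  rw [ctr, tr_nil, this, E_algebraMap, sub_self]

lemma mean_nil (hN : N ≠ 0) : M.mean [] = 1 := by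
  have h0 : (N : ℝ) ≠ 0 := by exact_mod_cast hN
  have : (N : R) = algebraMap ℝ R N := by simp
  rw [mean, tr_nil, this, E_algebraMap, inv_mul_cancel₀ h0]

@[simp] lemma moment_nil : M.moment [] = 1 := by simp [moment, E_one]

@[simp] lemma moment_singleton (w) : M.moment [w] = 0 := by simp [moment, E_ctr]

lemma moment_cons (w L) : M.moment (w :: L) = M.E (M.ctr w * (L.map M.ctr).prod) := by
  simp [moment]

@[simp] lemma moment_nil_cons (L) : M.moment ([] :: L) = 0 := by simp [moment_cons, ctr_nil]

lemma moment_pair (u v) : M.moment [u, v] =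
    M.E (M.tr u * M.tr v) - M.E (M.tr u) * M.E (M.tr v) := by
  have h : M.ctr u * M.ctr v = M.tr u * M.tr v - algebraMap ℝ R (M.E (M.tr u)) * M.tr v -
      algebraMap ℝ R (M.E (M.tr v)) * M.ctr u := by
    rw [ctr, ctr]; ring
  simp only [moment_cons, List.map_cons, List.map_nil, List.prod_cons, List.prod_nil, mul_one]
  rw [h, map_sub, map_sub, E_algebraMap_mul, E_algebraMap_mul, E_ctr]
  ring

lemma mean_cons (ε : ZMod 2) (w) : M.mean (ε :: w) =
    ∑ r ∈ Finset.range w.length,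
      (pairWeight γ (ε + w.getD r 0) * (M.mean (w.take r) * M.mean (w.drop (r + 1)) +
        (N : ℝ)⁻¹ * ((N : ℝ)⁻¹ * M.moment [w.take r, w.drop (r + 1)])) +
      pairWeight γ (ε + w.getD r 0 + 1) *
        ((N : ℝ)⁻¹ * M.mean (w.take r ++ wordTranspose (w.drop (r + 1))))) := by
  have h := M.schwingerDyson ε w 1
  simp only [mul_one, Derivation.map_one_eq_zero, map_zero, add_zero] at h
  rw [mean, h, Finset.mul_sum]
  refine Finset.sum_congr rfl fun r _ ↦ ?_
  rw [moment_pair]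
  simp only [mean]
  ring

lemma derivation_prod_ctr (d : Derivation ℝ R R) (L : List (List (ZMod 2))) :
    d (L.map M.ctr).prod = ∑ s ∈ Finset.range L.length,
      d (M.tr (L.getD s [])) * ((L.eraseIdx s).map M.ctr).prod := by
  induction L with
  | nil => simp
  | cons w L ih =>
    rw [List.map_cons, List.prod_cons, Derivation.leibniz, ih, List.length_cons,
      Finset.sum_range_succ', smul_eq_mul, smul_eq_mul, Finset.mul_sum]
    congr 1
    · refine Finset.sum_congr rfl fun s _ ↦ ?_
      simp
      ring
    · simp [ctr]
      ring

lemma E_tr_mul (hN : N ≠ 0) (w) (G : R) :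
    (N : ℝ)⁻¹ * M.E (M.tr w * G) = M.mean w * M.E G + (N : ℝ)⁻¹ * M.E (M.ctr w * G) := by
  have h0 : (N : ℝ) ≠ 0 := by exact_mod_cast hN
  rw [M.tr_eq hN, add_mul, map_add, E_algebraMap_mul]
  field_simp

/-- The Schwinger–Dyson equation in a form ready for induction: total length drops by two in every
term, and a term is either a product of a mean and a moment or carries `N⁻¹`. -/
lemma moment_cons_cons (hN : N ≠ 0) (ε : ZMod 2) (w) (L) : M.moment ((ε :: w) :: L) =
    ∑ r ∈ Finset.range w.length,
      (pairWeight γ (ε + w.getD r 0) * (M.mean (w.take r) * M.moment (w.drop (r + 1) :: L) +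
        M.mean (w.drop (r + 1)) * M.moment (w.take r :: L) +
        (N : ℝ)⁻¹ * (M.moment (w.take r :: w.drop (r + 1) :: L) -
          M.moment [w.take r, w.drop (r + 1)] * M.moment L)) +
      pairWeight γ (ε + w.getD r 0 + 1) *
        ((N : ℝ)⁻¹ * M.moment ((w.take r ++ wordTranspose (w.drop (r + 1))) :: L))) +
    ∑ s ∈ Finset.range L.length, ∑ r ∈ Finset.range (L.getD s []).length,
      (pairWeight γ (ε + (L.getD s []).getD r 0) *
        (M.mean (w ++ ((L.getD s []).drop (r + 1) ++ (L.getD s []).take r)) *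
            M.moment (L.eraseIdx s) +
          (N : ℝ)⁻¹ * M.moment
            ((w ++ ((L.getD s []).drop (r + 1) ++ (L.getD s []).take r)) :: L.eraseIdx s)) +
      pairWeight γ (ε + (L.getD s []).getD r 0 + 1) *
        (M.mean (w ++ wordTranspose ((L.getD s []).drop (r + 1) ++ (L.getD s []).take r)) *
            M.moment (L.eraseIdx s) +
          (N : ℝ)⁻¹ * M.moment
            ((w ++ wordTranspose ((L.getD s []).drop (r + 1) ++ (L.getD s []).take r)) ::
              L.eraseIdx s))) := by
  have h0 : (N : ℝ) ≠ 0 := by exact_mod_cast hN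
  set G : R := (L.map M.ctr).prod with hG
  -- With a centered test element, traces may replace centered traces: the deterministic part of
  -- size `N` is annihilated.
  set F : R := G - algebraMap ℝ R (M.E G) with hF
  have hEF : M.E F = 0 := by rw [hF, map_sub, E_algebraMap, sub_self]
  have hctr (u) : M.E (M.ctr u * F) = M.moment (u :: L) := by
    rw [hF, mul_sub, map_sub, mul_comm _ (algebraMap ℝ R _), E_algebraMap_mul, E_ctr, mul_zero,
      sub_zero, moment_cons]
  have htr (u) : M.E (M.tr u * F) = M.moment (u :: L) := by
    rw [M.tr_eq hN, add_mul, map_add, E_algebraMap_mul, hEF, mul_zero, zero_add, hctr]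
  have hpair (u v) : (N : ℝ)⁻¹ * M.E (M.tr u * M.tr v * F) =
      M.mean u * M.moment (v :: L) + M.mean v * M.moment (u :: L) +
      (N : ℝ)⁻¹ * (M.moment (u :: v :: L) - M.moment [u, v] * M.moment L) := by
    have h1 : M.E (M.ctr u * (M.ctr v * F)) =
        M.moment (u :: v :: L) - M.moment [u, v] * M.moment L := by
      have : M.ctr u * (M.ctr v * F) = M.ctr u * (M.ctr v * G) -
          algebraMap ℝ R (M.E G) * (M.ctr u * M.ctr v) := by rw [hF]; ring
      rw [this, map_sub, E_algebraMap_mul]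
      simp [moment, hG, mul_comm]
    rw [mul_assoc, M.E_tr_mul hN, htr, M.tr_eq hN v, add_mul, mul_add, map_add, h1,
      mul_left_comm, E_algebraMap_mul, hctr, mul_add]
    field_simp
    ring
  have hgrad : M.E (M.grad ε w F) = M.E (M.grad ε w G) := by
    rw [hF, map_sub, Derivation.map_algebraMap, sub_zero]
  rw [← htr, schwingerDyson, hgrad, hG, derivation_prod_ctr, map_sum]
  congr 1
  · refine Finset.sum_congr rfl fun r _ ↦ ?_
    rw [htr, ← hpair]
    ring
  · refine Finset.sum_congr rfl fun s _ ↦ ?_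
    rw [grad_tr, Finset.sum_mul, map_sum]
    refine Finset.sum_congr rfl fun r _ ↦ ?_
    simp only [moment_cons]
    rw [moment, ← M.E_tr_mul hN, ← M.E_tr_mul hN]
    simp only [smul_mul_assoc, add_mul, map_smul, map_add, smul_eq_mul]
    ring

end Moments

end EllipticModel

/-! ### Boundedness and the surviving terms as `N → ∞` -/

/-- Eventually bounded real sequences. -/
def EvBdd (f : ℕ → ℝ) : Prop := f =O[atTop] (fun _ ↦ (1 : ℝ))

namespace EvBdd

variable {f g : ℕ → ℝ}

lemma const (c : ℝ) : EvBdd fun _ ↦ c := Asymptotics.isBigO_const_const c one_ne_zero _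

lemma add (hf : EvBdd f) (hg : EvBdd g) : EvBdd fun N ↦ f N + g N := Asymptotics.IsBigO.add hf hg

lemma sub (hf : EvBdd f) (hg : EvBdd g) : EvBdd fun N ↦ f N - g N := Asymptotics.IsBigO.sub hf hg

lemma mul (hf : EvBdd f) (hg : EvBdd g) : EvBdd fun N ↦ f N * g N := by
  simpa [EvBdd] using Asymptotics.IsBigO.mul hf hg

lemma sum {ι : Type*} {s : Finset ι} {f : ι → ℕ → ℝ} (h : ∀ i ∈ s, EvBdd (f i)) :
    EvBdd fun N ↦ ∑ i ∈ s, f i N := Asymptotics.IsBigO.fun_sum h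

lemma _root_.Filter.Tendsto.evBdd {c : ℝ} (h : Tendsto f atTop (𝓝 c)) : EvBdd f :=
  h.isBigO_one ℝ

lemma inv : EvBdd fun N ↦ (N : ℝ)⁻¹ := tendsto_inv_atTop_nhds_zero_nat.evBdd

lemma congr (hf : EvBdd f) (h : ∀ N, N ≠ 0 → g N = f N) : EvBdd g :=
  Asymptotics.IsBigO.congr' hf
    ((eventually_ne_atTop 0).mono fun N hN ↦ (h N hN).symm) (EventuallyEq.refl _ _)

lemma tendsto_zero_mul (hf : EvBdd f) (hg : Tendsto g atTop (𝓝 0)) :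
    Tendsto (fun N ↦ g N * f N) atTop (𝓝 0) := by
  have h1 : g =o[atTop] (fun _ ↦ (1 : ℝ)) := (Asymptotics.isLittleO_one_iff ℝ).2 hg
  have := h1.mul_isBigO hf
  simp only [mul_one] at this
  exact (Asymptotics.isLittleO_one_iff ℝ).1 this

lemma tendsto_inv_mul (hf : EvBdd f) : Tendsto (fun N : ℕ ↦ (N : ℝ)⁻¹ * f N) atTop (𝓝 0) :=
  hf.tendsto_zero_mul tendsto_inv_atTop_nhds_zero_nat

end EvBdd

namespace EllipticModel

variable {γ : ℝ} {R : ℕ → Type*} [∀ N, CommRing (R N)] [∀ N, Algebra ℝ (R N)]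
  (M : ∀ N, EllipticModel γ N (R N))

/-- Means and moments occur in each other's recursions, so they are bounded by one joint induction
on total length. Only `N ≠ 0` matters, since boundedness is eventual. -/
lemma evBdd_of_length_le (n : ℕ) :
    (∀ w : List (ZMod 2), w.length ≤ n → EvBdd fun N ↦ (M N).mean w) ∧
    ∀ L : List (List (ZMod 2)), (L.map List.length).sum ≤ n → EvBdd fun N ↦ (M N).moment L := by
  induction n using Nat.strong_induction_on with
  | _ n ih =>
    have hmean (w : List (ZMod 2)) (hw : w.length < n) : EvBdd fun N ↦ (M N).mean w :=
      (ih _ hw).1 w le_rfl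
    have hmom (L : List (List (ZMod 2))) (hL : (L.map List.length).sum < n) :
      EvBdd fun N ↦ (M N).moment L := (ih _ hL).2 L le_rfl
    refine ⟨fun w hw ↦ ?_, fun L hL ↦ ?_⟩
    · cases w with
      | nil => exact (EvBdd.const 1).congr fun N hN ↦ (M N).mean_nil hN
      | cons ε w =>
        rw [List.length_cons] at hw
        simp only [mean_cons]
        refine EvBdd.sum fun r hr ↦ ?_
        rw [Finset.mem_range] at hr
        refine ((EvBdd.const _).mul (((hmean _ ?_).mul (hmean _ ?_)).add
          (EvBdd.inv.mul (EvBdd.inv.mul (hmom _ ?_))))).add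
          ((EvBdd.const _).mul (EvBdd.inv.mul (hmean _ ?_))) <;>
        simp <;> omega
    · cases L with
      | nil => simpa using EvBdd.const 1
      | cons w L =>
        cases w with
        | nil => simpa using EvBdd.const 0
        | cons ε w =>
          simp only [List.map_cons, List.length_cons, List.sum_cons] at hL
          refine EvBdd.congr ?_ fun N hN ↦ (M N).moment_cons_cons hN ε w L
          refine (EvBdd.sum fun r hr ↦ ?_).add (EvBdd.sum fun s hs ↦ EvBdd.sum fun r hr ↦ ?_)
          · rw [Finset.mem_range] at hr
            refine ((EvBdd.const _).mul ((((hmean _ ?_).mul (hmom _ ?_)).add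
              ((hmean _ ?_).mul (hmom _ ?_))).add (EvBdd.inv.mul ((hmom _ ?_).sub
              ((hmom _ ?_).mul (hmom _ ?_)))))).add
              ((EvBdd.const _).mul (EvBdd.inv.mul (hmom _ ?_))) <;>
            (try simp) <;> omega
          · rw [Finset.mem_range] at hr hs
            have hlen : (L.getD s []).length + ((L.eraseIdx s).map List.length).sum =
                (L.map List.length).sum := by
              rw [List.getD_eq_getElem _ _ hs]
              have := ((List.getElem_cons_eraseIdx_perm hs).map List.length).sum_eq
              simpa using this
            generalize L.getD s [] = w' at hr hlen ⊢
            refine ((EvBdd.const _).mul (((hmean _ ?_).mul (hmom _ ?_)).add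
              (EvBdd.inv.mul (hmom _ ?_)))).add ((EvBdd.const _).mul (((hmean _ ?_).mul
                (hmom _ ?_)).add (EvBdd.inv.mul (hmom _ ?_)))) <;>
            (try simp) <;> omega

lemma evBdd_mean (w : List (ZMod 2)) : EvBdd fun N ↦ (M N).mean w :=
  (evBdd_of_length_le M _).1 w le_rfl

lemma evBdd_moment (L : List (List (ZMod 2))) : EvBdd fun N ↦ (M N).moment L :=
  (evBdd_of_length_le M _).2 L le_rfl

lemma tendsto_mean_nil : Tendsto (fun N ↦ (M N).mean []) atTop (𝓝 1) :=
  tendsto_const_nhds.congr' ((eventually_ne_atTop 0).mono fun N hN ↦ ((M N).mean_nil hN).symm)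

lemma tendsto_mean_cons {ε : ZMod 2} {w : List (ZMod 2)} {l : ℕ → ℝ}
    (h : ∀ r < w.length, Tendsto (fun N ↦ pairWeight γ (ε + w.getD r 0) *
      ((M N).mean (w.take r) * (M N).mean (w.drop (r + 1)))) atTop (𝓝 (l r))) :
    Tendsto (fun N ↦ (M N).mean (ε :: w)) atTop (𝓝 (∑ r ∈ Finset.range w.length, l r)) := by
  simp only [mean_cons]
  refine tendsto_finsetSum _ fun r hr ↦ ?_
  have h1 := h r (Finset.mem_range.1 hr)
  have h2 := (EvBdd.inv.mul (evBdd_moment M [w.take r, w.drop (r + 1)])).tendsto_inv_mul.const_mul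
    (pairWeight γ (ε + w.getD r 0))
  have h3 := (evBdd_mean M (w.take r ++ wordTranspose (w.drop (r + 1)))).tendsto_inv_mul.const_mul
    (pairWeight γ (ε + w.getD r 0 + 1))
  simpa [mul_add] using (h1.add h2).add h3

/-- Limits are assumed for whole summands, not for factors: a moment not known to converge may still
be multiplied by a vanishing mean. -/
lemma tendsto_moment_cons {ε : ZMod 2} {w w' : List (ZMod 2)} {l l' : ℕ → ℝ}
    (h : ∀ r < w.length, Tendsto (fun N ↦ pairWeight γ (ε + w.getD r 0) *
      ((M N).mean (w.take r) * (M N).moment [w.drop (r + 1), w'] +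
        (M N).mean (w.drop (r + 1)) * (M N).moment [w.take r, w'])) atTop (𝓝 (l r)))
    (h' : ∀ r < w'.length, Tendsto (fun N ↦
      pairWeight γ (ε + w'.getD r 0) * (M N).mean (w ++ (w'.drop (r + 1) ++ w'.take r)) +
      pairWeight γ (ε + w'.getD r 0 + 1) *
        (M N).mean (w ++ wordTranspose (w'.drop (r + 1) ++ w'.take r))) atTop (𝓝 (l' r))) :
    Tendsto (fun N ↦ (M N).moment [ε :: w, w']) atTop
      (𝓝 (∑ r ∈ Finset.range w.length, l r + ∑ r ∈ Finset.range w'.length, l' r)) := by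
  have key : Tendsto (fun N ↦ ∑ r ∈ Finset.range w.length,
      (pairWeight γ (ε + w.getD r 0) * ((M N).mean (w.take r) * (M N).moment [w.drop (r + 1), w'] +
        (M N).mean (w.drop (r + 1)) * (M N).moment [w.take r, w']) +
       (N : ℝ)⁻¹ * (pairWeight γ (ε + w.getD r 0) *
          (M N).moment [w.take r, w.drop (r + 1), w'] +
        pairWeight γ (ε + w.getD r 0 + 1) *
          (M N).moment [w.take r ++ wordTranspose (w.drop (r + 1)), w'])) +
      ∑ r ∈ Finset.range w'.length, (pairWeight γ (ε + w'.getD r 0) *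
          (M N).mean (w ++ (w'.drop (r + 1) ++ w'.take r)) +
        pairWeight γ (ε + w'.getD r 0 + 1) *
        (M N).mean (w ++ wordTranspose (w'.drop (r + 1) ++ w'.take r)))) atTop
      (𝓝 (∑ r ∈ Finset.range w.length, (l r + 0) + ∑ r ∈ Finset.range w'.length, l' r)) := by
    refine (tendsto_finsetSum _ fun r hr ↦ ?_).add
      (tendsto_finsetSum _ fun r hr ↦ h' r (Finset.mem_range.1 hr))
    exact (h r (Finset.mem_range.1 hr)).add (((EvBdd.const _).mul (evBdd_moment M _)).add
      ((EvBdd.const _).mul (evBdd_moment M _))).tendsto_inv_mul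
  simp only [add_zero] at key
  refine key.congr' ((eventually_ne_atTop 0).mono fun N hN ↦ ?_)
  beta_reduce
  rw [moment_cons_cons _ hN]
  simp only [List.length_singleton, Finset.sum_range_one, List.getD_cons_zero,
    List.eraseIdx_cons_zero, moment_nil, moment_singleton, mul_one, mul_zero, add_zero, sub_zero]
  congr 1
  exact Finset.sum_congr rfl fun r _ ↦ by ring

end EllipticModel

/-! ### Words in progression and their flipped continuations -/

/-- The word `ε, ε + δ, ε + 2 δ, …` of length `n`: constant for `δ = 0`, alternating for
`δ = 1`. -/
def progWord (δ : ZMod 2) : ZMod 2 → ℕ → List (ZMod 2)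
  | _, 0 => []
  | ε, n + 1 => ε :: progWord δ (ε + δ) n

section ProgWord

variable (δ : ZMod 2)

@[simp] lemma length_progWord (ε : ZMod 2) (n : ℕ) : (progWord δ ε n).length = n := by
  induction n generalizing ε with
  | zero => rfl
  | succ n ih => simp [progWord, ih]

lemma progWord_add (ε : ZMod 2) (m n : ℕ) :
    progWord δ ε (m + n) = progWord δ ε m ++ progWord δ (ε + m * δ) n := by
  induction m generalizing ε with
  | zero => simp [progWord]
  | succ m ih =>
    rw [Nat.succ_add, progWord, ih, progWord, List.cons_append]
    push_cast
    ring_nf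

lemma progWord_split (ε : ZMod 2) (r j : ℕ) : progWord δ ε (r + 1 + j) =
    progWord δ ε r ++ (ε + r * δ) :: progWord δ (ε + r * δ + δ) j := by
  rw [add_assoc, progWord_add, add_comm 1 j, progWord]

lemma take_append_cons (u : List (ZMod 2)) (x : ZMod 2) (v : List (ZMod 2)) {r : ℕ}
    (hr : u.length = r) : (u ++ x :: v).take r = u := by
  subst hr; simp

lemma drop_append_cons (u : List (ZMod 2)) (x : ZMod 2) (v : List (ZMod 2)) {r : ℕ}
    (hr : u.length = r) : (u ++ x :: v).drop (r + 1) = v := by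
  subst hr; simp

lemma getD_append_cons (u : List (ZMod 2)) (x : ZMod 2) (v : List (ZMod 2)) {r : ℕ}
    (hr : u.length = r) : (u ++ x :: v).getD r 0 = x := by
  subst hr; simp

/-- Modulo `2` the steps `δ` and `-δ` agree, so the reversed word is again a progression. It starts
at the flipped last letter, `ε + (n - 1) δ + 1`. -/
lemma wordTranspose_progWord (ε : ZMod 2) (n : ℕ) :
    wordTranspose (progWord δ ε n) = progWord δ (ε + 1 + δ + n * δ) n := by
  induction n generalizing ε with
  | zero => rfl
  | succ n ih =>
    have h : wordTranspose (progWord δ ε (n + 1)) =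
        wordTranspose (progWord δ (ε + δ) n) ++ [ε + 1] := by
      simp [wordTranspose, progWord]
    have h1 : ∀ e d x : ZMod 2, e + d + 1 + d + x * d = e + 1 + d + (x + 1) * d := by decide
    have h2 : ∀ e d x : ZMod 2, e + 1 + d + (x + 1) * d + x * d = e + 1 := by decide
    rw [h, ih, progWord_add, h1]
    push_cast
    simp [progWord, h2]

/-- A word of length `n` followed by its flipped continuation of length `k`. -/
def twistedWord (ε : ZMod 2) (n k : ℕ) : List (ZMod 2) :=
  progWord δ ε n ++ progWord δ (ε + n * δ + 1) k

lemma twistedWord_zero_right (ε : ZMod 2) (n : ℕ) :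
    twistedWord δ ε n 0 = progWord δ ε n := by simp [twistedWord, progWord]

lemma twistedWord_zero_left (ε : ZMod 2) (k : ℕ) :
    twistedWord δ ε 0 k = progWord δ (ε + 1) k := by simp [twistedWord, progWord]

@[simp] lemma length_twistedWord (ε : ZMod 2) (n k : ℕ) :
    (twistedWord δ ε n k).length = n + k := by simp [twistedWord]

lemma twistedWord_split_left (ε : ZMod 2) (r j k : ℕ) :
    twistedWord δ ε (r + 1 + j) k =
      progWord δ ε r ++ (ε + r * δ) :: twistedWord δ (ε + r * δ + δ) j k := by
  rw [twistedWord, progWord_split, twistedWord, List.append_assoc, List.cons_append]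
  push_cast
  ring_nf

lemma twistedWord_split_right (ε : ZMod 2) (n r j : ℕ) :
    twistedWord δ ε n (r + 1 + j) =
      twistedWord δ ε n r ++ (ε + n * δ + 1 + r * δ) ::
        progWord δ (ε + n * δ + 1 + r * δ + δ) j := by
  rw [twistedWord, progWord_split, twistedWord, List.append_assoc]

lemma twistedWord_succ (ε : ZMod 2) (n k : ℕ) :
    twistedWord δ ε (n + 1) k = ε :: twistedWord δ (ε + δ) n k := by
  simpa [progWord, add_comm 1 n] using twistedWord_split_left δ ε 0 n k

end ProgWord

/-! ### Limits of means and covariances for these words -/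

namespace EllipticModel

variable {γ : ℝ} {R : ℕ → Type*} [∀ N, CommRing (R N)] [∀ N, Algebra ℝ (R N)]
  (M : ∀ N, EllipticModel γ N (R N)) (δ : ZMod 2)

lemma tendsto_mean_twistedWord_succ (ε : ZMod 2) (n k : ℕ)
    (ih : ∀ ε' n' k', n' + k' < n + 1 + k → Tendsto (fun N ↦ (M N).mean (twistedWord δ ε' n' k'))
      atTop (𝓝 (ballotPair (pairWeight γ δ) (pairWeight γ (δ + 1)) n' k'))) :
    Tendsto (fun N ↦ (M N).mean (twistedWord δ ε (n + 1) k)) atTop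
      (𝓝 (ballotPair (pairWeight γ δ) (pairWeight γ (δ + 1)) (n + 1) k)) := by
  set α := pairWeight γ δ with hα
  set β := pairWeight γ (δ + 1) with hβ
  have ihp (ε' n') (h : n' < n + 1 + k) : Tendsto (fun N ↦ (M N).mean (progWord δ ε' n'))
      atTop (𝓝 (ballot α n' 0)) := by
    simpa only [twistedWord_zero_right, ballotPair_zero_right] using ih ε' n' 0 h
  -- The partner of the first letter ranges over one index; `r < n` lies in the first block, the
  -- rest in the flipped one.
  have hsum : ballotPair α β (n + 1) k = ∑ r ∈ Finset.range (n + k),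
      if r < n then α * (ballot α r 0 * ballotPair α β (n - 1 - r) k)
      else β * (ballotPair α β n (r - n) * ballot α (k - 1 - (r - n)) 0) := by
    rw [Finset.sum_range_add, ballotPair_succ_left, Finset.mul_sum, Finset.mul_sum]
    congr 1
    · exact Finset.sum_congr rfl fun r hr ↦ by rw [if_pos (Finset.mem_range.1 hr)]
    · exact Finset.sum_congr rfl fun r hr ↦ by simp
  rw [twistedWord_succ, hsum, ← length_twistedWord δ (ε + δ) n k]
  refine tendsto_mean_cons M fun r hr ↦ ?_
  rw [length_twistedWord] at hr
  split_ifs with hrn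
  · obtain ⟨j, rfl⟩ := Nat.exists_eq_add_of_lt hrn
    rw [show r + j + 1 = r + 1 + j by ring, twistedWord_split_left,
      take_append_cons _ _ _ (by simp), drop_append_cons _ _ _ (by simp),
      getD_append_cons _ _ _ (by simp), show r + 1 + j - 1 - r = j by omega]
    have h := (ihp (ε + δ) r (by omega)).mul (ih (ε + δ + r * δ + δ) j k (by omega))
    rcases Nat.even_or_odd r with he | ho
    · have h1 : ε + (ε + δ + r * δ) = δ := by
        rw [(ZMod.natCast_eq_zero_iff_even).2 he]
        have : ∀ e d : ZMod 2, e + (e + d + 0 * d) = d := by decide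
        exact this _ _
      rw [h1]
      exact h.const_mul _
    -- The weight may be the wrong one here, but a piece of odd length has vanishing limit mean.
    · rw [ballot_of_odd α r 0 (by simpa using ho)] at h ⊢
      simpa using h.const_mul (pairWeight γ (ε + (ε + δ + r * δ)))
  · obtain ⟨i, rfl⟩ := Nat.exists_eq_add_of_le (not_lt.1 hrn)
    obtain ⟨j, rfl⟩ := Nat.exists_eq_add_of_lt (show i < k by omega)
    rw [show i + j + 1 = i + 1 + j by ring, twistedWord_split_right,
      take_append_cons _ _ _ (by simp), drop_append_cons _ _ _ (by simp),
      getD_append_cons _ _ _ (by simp), show n + i - n = i by omega,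
      show i + 1 + j - 1 - i = j by omega]
    have h := (ih (ε + δ) n i (by omega)).mul
      (ihp (ε + δ + n * δ + 1 + i * δ + δ) j (by omega))
    rcases Nat.even_or_odd (n + i) with he | ho
    · have h1 : ε + (ε + δ + n * δ + 1 + i * δ) = δ + 1 := by
        have : (n : ZMod 2) + i = 0 := by
          exact_mod_cast (ZMod.natCast_eq_zero_iff_even).2 he
        have h2 : ∀ e d x y : ZMod 2, x + y = 0 → e + (e + d + x * d + 1 + y * d) = d + 1 := by
          decide
        exact h2 _ _ _ _ this
      rw [h1]
      exact h.const_mul _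
    · rw [ballotPair_of_odd α β n i ho] at h ⊢
      simpa using h.const_mul (pairWeight γ (ε + (ε + δ + n * δ + 1 + i * δ)))

lemma tendsto_mean_twistedWord (ε : ZMod 2) (n k : ℕ) :
    Tendsto (fun N ↦ (M N).mean (twistedWord δ ε n k)) atTop
      (𝓝 (ballotPair (pairWeight γ δ) (pairWeight γ (δ + 1)) n k)) := by
  induction hs : n + k using Nat.strong_induction_on generalizing ε n k with
  | _ s ih =>
    subst hs
    rcases n with _ | n
    · rcases k with _ | k
      · simpa [twistedWord, progWord, ballot] using tendsto_mean_nil M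
      -- With an empty first block the word is a plain progression, so the blocks can be exchanged
      -- to make the first one nonempty.
      · rw [twistedWord_zero_left, ← twistedWord_zero_right, ballotPair_comm]
        exact tendsto_mean_twistedWord_succ M δ _ _ _ fun ε' n' k' h ↦ ih _ (by omega) ε' n' k' rfl
    · exact tendsto_mean_twistedWord_succ M δ _ _ _ fun ε' n' k' h ↦ ih _ (by omega) ε' n' k' rfl

lemma tendsto_mean_progWord (ε : ZMod 2) (n : ℕ) :
    Tendsto (fun N ↦ (M N).mean (progWord δ ε n)) atTop (𝓝 (ballot (pairWeight γ δ) n 0)) := by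
  simpa only [twistedWord_zero_right, ballotPair_zero_right] using
    tendsto_mean_twistedWord M δ ε n 0

/-- A welded word consists of two progressions, the second either continuing the first or flipped
against it; `ε + x` decides both this and the weight. For `δ = 1` the hypothesis says that the
opened word had even length. -/
lemma tendsto_weight_mul_mean (ε x : ZMod 2) (p m : ℕ) (hp : ((p + 1 : ℕ) : ZMod 2) * δ = 0) :
    Tendsto (fun N ↦ pairWeight γ (ε + x) *
      (M N).mean (progWord δ (ε + δ) p ++ progWord δ (x + δ) m)) atTop
      (𝓝 (if ε + x = δ then pairWeight γ δ * ballot (pairWeight γ δ) (p + m) 0 else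
        pairWeight γ (δ + 1) *
          ballotPair (pairWeight γ δ) (pairWeight γ (δ + 1)) p m)) := by
  push_cast at hp
  split_ifs with h
  · have h1 : x + δ = ε + δ + p * δ := by
      have : ∀ e y d z : ZMod 2, (z + 1) * d = 0 → e + y = d → y + d = e + d + z * d := by decide
      exact this _ _ _ _ hp h
    rw [h1, ← progWord_add, h]
    exact (tendsto_mean_progWord M δ _ _).const_mul _
  · have h1 : x + δ = ε + δ + p * δ + 1 := by
      have : ∀ e y d z : ZMod 2, (z + 1) * d = 0 → e + y ≠ d → y + d = e + d + z * d + 1 := by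
        decide
      exact this _ _ _ _ hp h
    have h2 : ε + x = δ + 1 := by
      have : ∀ e y d : ZMod 2, e + y ≠ d → e + y = d + 1 := by decide
      exact this _ _ _ h
    rw [h1, h2]
    exact (tendsto_mean_twistedWord M δ (ε + δ) p m).const_mul _

lemma tendsto_moment_progWord (ε ε' : ZMod 2) (p q : ℕ) (hp : (p : ZMod 2) * δ = 0)
    (hq : ((q + 1 : ℕ) : ZMod 2) * δ = 0) :
    Tendsto (fun N ↦ (M N).moment [progWord δ ε p, progWord δ ε' (q + 1)]) atTop
      (𝓝 (limitCov (pairWeight γ δ) (pairWeight γ (δ + 1)) p (q + 1))) := by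
  induction p using Nat.strong_induction_on generalizing ε with
  | _ p ih =>
    rcases p with _ | p
    · simp [progWord, limitCov_zero_left]
    set α := pairWeight γ δ with hα
    set β := pairWeight γ (δ + 1) with hβ
    have hsum : limitCov α β (p + 1) (q + 1) = ∑ r ∈ Finset.range p,
        α * (ballot α r 0 * limitCov α β (p - 1 - r) (q + 1) +
          ballot α (p - 1 - r) 0 * limitCov α β r (q + 1)) +
        ∑ r ∈ Finset.range (q + 1), (α * ballot α (p + q) 0 + β * ballotPair α β p q) := by
      rw [limitCov_succ_succ, ← Finset.mul_sum, Finset.sum_add_distrib,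
        sum_range_reflect_sub (fun i j ↦ ballot α i 0 * limitCov α β j (q + 1))]
      simp
      ring
    rw [progWord, hsum]
    -- The summation ranges are rewritten as word lengths, the form in which `tendsto_moment_cons`
    -- states its limit.
    conv => enter [3, 1, 1, 1, 1]; rw [← length_progWord δ (ε + δ) p]
    conv => enter [3, 1, 2, 1, 1]; rw [← length_progWord δ ε' (q + 1)]
    refine tendsto_moment_cons M (fun r hr ↦ ?_) fun r hr ↦ ?_
    · rw [length_progWord] at hr
      obtain ⟨j, rfl⟩ := Nat.exists_eq_add_of_lt hr
      rw [show r + j + 1 = r + 1 + j by ring, progWord_split,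
        take_append_cons _ _ _ (by simp), drop_append_cons _ _ _ (by simp),
        getD_append_cons _ _ _ (by simp), show r + 1 + j - 1 - r = j by omega]
      push_cast at hp
      by_cases hrδ : (r : ZMod 2) * δ = 0
      · have hjδ : (j : ZMod 2) * δ = 0 := by
          have : ∀ x y d : ZMod 2, (x + y + 1 + 1) * d = 0 → x * d = 0 → y * d = 0 := by decide
          exact this _ _ _ hp hrδ
        have h1 : ε + (ε + δ + r * δ) = δ := by
          rw [hrδ]
          have : ∀ e d : ZMod 2, e + (e + d + 0) = d := by decide
          exact this _ _
        rw [h1]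
        exact (((tendsto_mean_progWord M δ _ r).mul (ih j (by omega) _ hjδ)).add
          ((tendsto_mean_progWord M δ _ j).mul (ih r (by omega) _ hrδ))).const_mul _
      -- For alternating words both pieces are odd here, so the induction hypothesis does not cover
      -- them. Their means tend to `0` while the moments stay bounded.
      · have hr1 : (r : ZMod 2) = 1 ∧ (j : ZMod 2) = 1 := by
          have : ∀ x y d : ZMod 2, (x + y + 1 + 1) * d = 0 → x * d ≠ 0 → x = 1 ∧ y = 1 := by decide
          exact this _ _ _ hp hrδ
        have hro : ballot α r 0 = 0 := ballot_of_odd α r 0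
          (by simpa using (ZMod.natCast_eq_one_iff_odd).1 hr1.1)
        have hjo : ballot α j 0 = 0 := ballot_of_odd α j 0
          (by simpa using (ZMod.natCast_eq_one_iff_odd).1 hr1.2)
        have h1 := tendsto_mean_progWord M δ (ε + δ) r
        have h2 := tendsto_mean_progWord M δ (ε + δ + r * δ + δ) j
        rw [hro] at h1
        rw [hjo] at h2
        rw [hro, hjo]
        simpa using (((evBdd_moment M _).tendsto_zero_mul h1).add
          ((evBdd_moment M _).tendsto_zero_mul h2)).const_mul _
    · rw [length_progWord] at hr
      obtain ⟨j, hj⟩ := Nat.exists_eq_add_of_lt hr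
      obtain rfl : q = r + j := by omega
      -- The length condition `hq` makes the second word cyclically consistent, so removing a letter
      -- leaves a progression after rotation.
      have hrot : progWord δ (ε' + r * δ + δ) j ++ progWord δ ε' r =
          progWord δ (ε' + r * δ + δ) (r + j) := by
        have h1 : ε' = ε' + r * δ + δ + j * δ := by
          have : ∀ e x y d : ZMod 2, (x + y + 1) * d = 0 → e = e + x * d + d + y * d := by decide
          push_cast at hq
          exact this _ _ _ _ hq
        rw [add_comm r j, progWord_add, ← h1]
      have htr : wordTranspose (progWord δ (ε' + r * δ + δ) (r + j)) =
          progWord δ (ε' + r * δ + 1 + δ) (r + j) := by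
        rw [wordTranspose_progWord]
        congr 1
        have : ∀ e x y d : ZMod 2, (x + 1) * d = 0 → e + y * d + d + 1 + d + x * d =
          e + y * d + 1 + d := by decide
        push_cast at hq
        have h2 := this ε' (r + j) r δ hq
        push_cast
        exact h2
      rw [show r + j + 1 = r + 1 + j by ring, progWord_split,
        take_append_cons _ _ _ (by simp), drop_append_cons _ _ _ (by simp),
        getD_append_cons _ _ _ (by simp), hrot, htr]
      have h1 := tendsto_weight_mul_mean M δ ε (ε' + r * δ) p (r + j) hp
      have h2 := tendsto_weight_mul_mean M δ ε (ε' + r * δ + 1) p (r + j) hp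
      rw [← add_assoc ε] at h2
      convert h1.add h2 using 2
      -- The direct and transposed weldings differ by one flip, so exactly one is continued and the
      -- other flipped: every `r` contributes the same sum.
      by_cases h : ε + (ε' + r * δ) = δ
      · rw [if_pos h, if_neg]
        rw [h]
        simp
      · rw [if_neg h, if_pos, add_comm]
        have : ∀ x d : ZMod 2, x ≠ d → x + 1 = d := by decide
        exact this _ _ h

end EllipticModel

/-! ### Gaussian integration by parts for polynomials -/

section GaussianPolynomials

lemma integrable_pow_gaussianReal (n : ℕ) :
    Integrable (fun x : ℝ ↦ x ^ n) (gaussianReal 0 1) := by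
  have h : MemLp (fun x : ℝ ↦ x) n (gaussianReal 0 1) := memLp_id_gaussianReal n
  exact h.integrable_norm_pow'.mono' (by fun_prop) (by simp)

lemma integrable_pow_mul_gaussianPDFReal (n : ℕ) :
    Integrable (fun x : ℝ ↦ x ^ n * gaussianPDFReal 0 1 x) := by
  have h := integrable_pow_gaussianReal n
  rw [gaussianReal_of_var_ne_zero _ one_ne_zero, integrable_withDensity_iff_integrable_smul'
    (measurable_gaussianPDF 0 1) (ae_of_all _ fun _ ↦ gaussianPDF_lt_top)] at h
  refine h.congr (ae_of_all _ fun x ↦ ?_)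
  simp [toReal_gaussianPDF, mul_comm]

lemma hasDerivAt_gaussianPDFReal (x : ℝ) :
    HasDerivAt (gaussianPDFReal 0 1) (-x * gaussianPDFReal 0 1 x) x := by
  have h1 : HasDerivAt (fun x : ℝ ↦ -(x - 0) ^ 2 / (2 * (1 : NNReal))) (-x) x := by
    have h : (fun x : ℝ ↦ -(x - 0) ^ 2 / (2 * (1 : NNReal))) = fun x ↦ -(x ^ 2) / 2 := by
      ext y
      simp
    rw [h]
    exact ((hasDerivAt_pow 2 x).fun_neg.div_const 2).congr_deriv (by simp; ring)
  rw [gaussianPDFReal_def]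
  exact (h1.exp.const_mul (√(2 * Real.pi * (1 : NNReal)))⁻¹).congr_deriv (by ring)

/-- Integration by parts against the density, whose derivative is `-x` times itself. For `n = 0` the
truncated exponent `n - 1` is harmless because of the factor `n`. -/
lemma integral_pow_succ_gaussianReal (n : ℕ) :
    ∫ x : ℝ, x ^ (n + 1) ∂gaussianReal 0 1 = n * ∫ x : ℝ, x ^ (n - 1) ∂gaussianReal 0 1 := by
  rw [integral_gaussianReal_eq_integral_smul one_ne_zero,
    integral_gaussianReal_eq_integral_smul one_ne_zero]
  have h := integral_mul_deriv_eq_deriv_mul_of_integrable (u := fun x : ℝ ↦ x ^ n)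
    (v := gaussianPDFReal 0 1) (u' := fun x ↦ n * x ^ (n - 1))
    (v' := fun x ↦ -x * gaussianPDFReal 0 1 x) (fun x _ ↦ hasDerivAt_pow n x)
    (fun x _ ↦ hasDerivAt_gaussianPDFReal x) ?_ ?_ (integrable_pow_mul_gaussianPDFReal n)
  · simp only [neg_mul, mul_neg, integral_neg, neg_inj, mul_assoc, integral_const_mul] at h
    simp only [smul_eq_mul, mul_comm (gaussianPDFReal 0 1 _)]
    rw [← h]
    congr 1
    ext x
    ring
  · convert (integrable_pow_mul_gaussianPDFReal (n + 1)).neg using 1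
    ext x
    simp
    ring
  · convert (integrable_pow_mul_gaussianPDFReal (n - 1)).const_mul (n : ℝ) using 1
    ext x
    simp
    ring

variable {ι : Type*} [Fintype ι]

/-- The standard Gaussian measure on `ι → ℝ`. -/
noncomputable def stdGaussianPi (ι : Type*) [Fintype ι] : Measure (ι → ℝ) :=
  Measure.pi fun _ ↦ gaussianReal 0 1

instance : IsProbabilityMeasure (stdGaussianPi ι) := by
  unfold stdGaussianPi; infer_instance

lemma eval_monomial_eq_prod (s : ι →₀ ℕ) (c : ℝ) (g : ι → ℝ) :
    MvPolynomial.eval g (MvPolynomial.monomial s c) = c * ∏ i, g i ^ s i := by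
  rw [MvPolynomial.eval_monomial, Finsupp.prod_fintype _ _ (by simp)]

lemma integrable_eval_stdGaussianPi (p : MvPolynomial ι ℝ) :
    Integrable (fun g ↦ MvPolynomial.eval g p) (stdGaussianPi ι) := by
  induction p using MvPolynomial.induction_on' with
  | monomial s c =>
    simp only [eval_monomial_eq_prod]
    exact (Integrable.fintype_prod fun i ↦ integrable_pow_gaussianReal (s i)).const_mul c
  | add p q hp hq =>
    simp only [map_add]
    exact hp.add hq

/-- The Gaussian expectation of a polynomial. -/
noncomputable def gaussianExp (ι : Type*) [Fintype ι] : MvPolynomial ι ℝ →ₗ[ℝ] ℝ where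
  toFun p := ∫ g, MvPolynomial.eval g p ∂stdGaussianPi ι
  map_add' p q := by
    simp only [map_add]
    exact integral_add (integrable_eval_stdGaussianPi p) (integrable_eval_stdGaussianPi q)
  map_smul' c p := by
    simp [MvPolynomial.smul_eval, integral_const_mul]

lemma gaussianExp_apply (p : MvPolynomial ι ℝ) :
    gaussianExp ι p = ∫ g, MvPolynomial.eval g p ∂stdGaussianPi ι := rfl

lemma gaussianExp_monomial (s : ι →₀ ℕ) (c : ℝ) :
    gaussianExp ι (MvPolynomial.monomial s c) =
      c * ∏ i, ∫ x : ℝ, x ^ s i ∂gaussianReal 0 1 := by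
  rw [gaussianExp_apply]
  simp only [eval_monomial_eq_prod]
  rw [integral_const_mul, stdGaussianPi, integral_fintype_prod_eq_prod (fun i x ↦ x ^ s i)]

lemma gaussianExp_one : gaussianExp ι 1 = 1 := by simp [gaussianExp_apply]

lemma gaussianExp_X_mul [DecidableEq ι] (k : ι) (p : MvPolynomial ι ℝ) :
    gaussianExp ι (MvPolynomial.X k * p) = gaussianExp ι (MvPolynomial.pderiv k p) := by
  induction p using MvPolynomial.induction_on' with
  | monomial s c =>
    rw [MvPolynomial.pderiv_monomial, mul_comm, MvPolynomial.X, MvPolynomial.monomial_mul,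
      gaussianExp_monomial, gaussianExp_monomial,
      ← Finset.mul_prod_erase _ _ (Finset.mem_univ k),
      ← Finset.mul_prod_erase Finset.univ 
        (fun i ↦ ∫ x : ℝ, x ^ (s - Finsupp.single k 1 : ι →₀ ℕ) i ∂gaussianReal 0 1)
        (Finset.mem_univ k)]
    have h : ∏ i ∈ Finset.univ.erase k, ∫ x : ℝ, x ^ (s + Finsupp.single k 1 : ι →₀ ℕ) i
          ∂gaussianReal 0 1 =
        ∏ i ∈ Finset.univ.erase k,
          ∫ x : ℝ, x ^ (s - Finsupp.single k 1 : ι →₀ ℕ) i ∂gaussianReal 0 1 := by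
      refine Finset.prod_congr rfl fun i hi ↦ ?_
      have : k ≠ i := (Finset.ne_of_mem_erase hi).symm
      simp [this]
    rw [h]
    simp only [Finsupp.add_apply, Finsupp.tsub_apply, Finsupp.single_eq_same]
    rw [integral_pow_succ_gaussianReal]
    ring
  | add p q hp hq => simp only [mul_add, map_add, hp, hq]

end GaussianPolynomials

/-! ### The Gaussian realization and equality of laws -/

/-- The coordinates `(i, j)` or `(j, i)` of the entry `i j` of a matrix or of its transpose. -/
def entryIndex {N : ℕ} (ε : ZMod 2) (i j : Fin N) : Fin N × Fin N :=
  if ε = 0 then (i, j) else (j, i)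

/-- The model `N^{-1/2} (a G + b Gᵀ)` with `G` a matrix of independent standard Gaussians. -/
noncomputable def gaussianModel (a b : ℝ) (h : a ^ 2 + b ^ 2 = 1) (N : ℕ) :
    EllipticModel (2 * a * b) N (MvPolynomial (Fin N × Fin N) ℝ) where
  E := gaussianExp (Fin N × Fin N)
  E_one := gaussianExp_one
  A ε := .of fun i j ↦ (√(N : ℝ))⁻¹ • (a • MvPolynomial.X (entryIndex ε i j) +
    b • MvPolynomial.X (entryIndex (ε + 1) i j))
  A_transpose ε := by
    have h : ∀ x : ZMod 2, x = 0 ∨ x = 1 := by decide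
    ext1 i j
    rcases h ε with rfl | rfl <;> simp [entryIndex, show (1 + 1 : ZMod 2) = 0 from rfl]
  -- The same linear combination as in `A`, with partial derivatives in place of variables, so `ibp`
  -- is the one-variable identity applied termwise.
  D ε i j := (√(N : ℝ))⁻¹ • (a • MvPolynomial.pderiv (entryIndex ε i j) +
    b • MvPolynomial.pderiv (entryIndex (ε + 1) i j))
  ibp ε i j p := by
    simp [add_mul, gaussianExp_X_mul]
  D_A ε i j ε' := by
    have h2 : ∀ x : ZMod 2, x = 0 ∨ x = 1 := by decide
    have h11 : (1 + 1 : ZMod 2) = 0 := rfl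
    have hN : (N : ℝ)⁻¹ = (√(N : ℝ))⁻¹ * (√(N : ℝ))⁻¹ := by
      rw [← mul_inv, Real.mul_self_sqrt (Nat.cast_nonneg N)]
    have hs : (N : ℝ)⁻¹ • (1 : MvPolynomial (Fin N × Fin N) ℝ) =
        ((√(N : ℝ))⁻¹ * (√(N : ℝ))⁻¹ * (a * a + b * b)) • 1 := by
      rw [← hN, ← sq, ← sq, h, mul_one]
    ext1 k l
    have hX (i j k l : Fin N) : MvPolynomial.pderiv (i, j)
        (MvPolynomial.X (k, l) : MvPolynomial (Fin N × Fin N) ℝ) =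
        if i = k ∧ j = l then 1 else 0 := by
      rw [MvPolynomial.pderiv_X, Pi.single_apply]
      exact if_congr (by rw [Prod.mk.injEq, eq_comm, @eq_comm _ l]) rfl rfl
    rcases h2 ε with rfl | rfl <;> rcases h2 ε' with rfl | rfl <;>
    simp [pairWeight, entryIndex, h11, hX, Matrix.single_apply]
    all_goals
      simp only [hs]
      simp only [and_comm (a := j = l), and_comm (a := j = k), hN]
      split_ifs <;> module

/-- Centered Gaussian vectors with the same covariances have the same law. -/
lemma map_eq_map_of_hasGaussianLaw {ι Ω Ω' : Type*} [Fintype ι] [MeasurableSpace Ω]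
    [MeasurableSpace Ω'] {P : Measure Ω} {P' : Measure Ω'} {Y : Ω → ι → ℝ} {Z : Ω' → ι → ℝ}
    (hY : HasGaussianLaw Y P) (hZ : HasGaussianLaw Z P')
    (hY0 : ∀ k, ∫ ω, Y ω k ∂P = 0) (hZ0 : ∀ k, ∫ ω, Z ω k ∂P' = 0)
    (hYZ : ∀ k l, ∫ ω, Y ω k * Y ω l ∂P = ∫ ω, Z ω k * Z ω l ∂P') : P.map Y = P'.map Z := by
  classical
  have := hY.isProbabilityMeasure
  have := hZ.isProbabilityMeasure
  have := hY.isGaussian_map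
  have := hZ.isGaussian_map
  have hYm (k) : MemLp (fun ω ↦ Y ω k) 2 P := (hY.eval k).memLp_two
  have hZm (k) : MemLp (fun ω ↦ Z ω k) 2 P' := (hZ.eval k).memLp_two
  -- Each linear functional of a Gaussian vector has a characteristic function determined by its
  -- mean and variance, so it suffices to compare those.
  refine Measure.ext_of_charFunDual (funext fun L ↦ ?_)
  obtain ⟨c, hL⟩ : ∃ c : ι → ℝ, ∀ y, L y = ∑ k, c k * y k := by
    refine ⟨fun k ↦ L (Pi.single k 1), fun y ↦ ?_⟩
    conv_lhs => rw [← Finset.univ_sum_single y]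
    rw [map_sum]
    refine Finset.sum_congr rfl fun k _ ↦ ?_
    rw [mul_comm, ← smul_eq_mul, ← map_smul, ← Pi.single_smul, smul_eq_mul, mul_one]
  rw [hY.charFunDual_map_eq_fun, hZ.charFunDual_map_eq_fun]
  have h1 : ∫ ω, L (Y ω) ∂P = ∫ ω, L (Z ω) ∂P' := by
    simp only [hL]
    rw [integral_finsetSum _ fun k _ ↦ ((hYm k).integrable one_le_two).const_mul _,
      integral_finsetSum _ fun k _ ↦ ((hZm k).integrable one_le_two).const_mul _]
    simp [integral_const_mul, hY0, hZ0]
  have h2 : Var[fun ω ↦ L (Y ω); P] = Var[fun ω ↦ L (Z ω); P'] := by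
    have hLY : AEMeasurable (fun ω ↦ L (Y ω)) P :=
      L.continuous.measurable.comp_aemeasurable hY.aemeasurable
    have hLZ : AEMeasurable (fun ω ↦ L (Z ω)) P' :=
      L.continuous.measurable.comp_aemeasurable hZ.aemeasurable
    rw [← covariance_self hLY, ← covariance_self hLZ]
    simp only [hL]
    rw [covariance_fun_sum_fun_sum (fun k ↦ (hYm k).const_mul _) fun k ↦ (hYm k).const_mul _,
      covariance_fun_sum_fun_sum (fun k ↦ (hZm k).const_mul _) fun k ↦ (hZm k).const_mul _]
    refine Finset.sum_congr rfl fun k _ ↦ Finset.sum_congr rfl fun l _ ↦ ?_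
    rw [covariance_const_mul_left, covariance_const_mul_left, covariance_const_mul_right,
      covariance_const_mul_right, covariance_eq_sub (hYm k) (hYm l),
      covariance_eq_sub (hZm k) (hZm l)]
    simp only [Pi.mul_apply, hY0, hZ0, hYZ]
  rw [h1, h2]

section EllipticLaw

variable {Ω : Type*} [MeasurableSpace Ω] {N : ℕ} {γ : ℝ} {X : Ω → Matrix (Fin N) (Fin N) ℝ}
  {P : Measure Ω}

lemma IsRealGaussianElliptic.hasGaussianLaw_pair (hX : IsRealGaussianElliptic γ X P)
    (i j : Fin N) (h : i ≤ j) : HasGaussianLaw (fun ω ↦ (X ω i j, X ω j i)) P := by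
  rcases h.eq_or_lt with rfl | h
  · exact (hX.gaussian_diag i).map_fun
      ((ContinuousLinearMap.id ℝ ℝ).prod (ContinuousLinearMap.id ℝ ℝ))
  · exact hX.gaussian_offDiag i j h

lemma IsRealGaussianElliptic.hasGaussianLaw (hX : IsRealGaussianElliptic γ X P) :
    HasGaussianLaw (fun ω (k : Fin N × Fin N) ↦ X ω k.1 k.2) P := by
  have h := hX.indep.hasGaussianLaw
    fun e : {e : Fin N × Fin N // e.1 ≤ e.2} ↦ hX.hasGaussianLaw_pair e.1.1 e.1.2 e.2
  let T : ({e : Fin N × Fin N // e.1 ≤ e.2} → ℝ × ℝ) →L[ℝ] (Fin N × Fin N → ℝ) :=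
    ContinuousLinearMap.pi fun k : Fin N × Fin N ↦
    if hk : k.1 ≤ k.2 then
      (ContinuousLinearMap.fst ℝ ℝ ℝ).comp (ContinuousLinearMap.proj (R := ℝ)
        (φ := fun _ : {e : Fin N × Fin N // e.1 ≤ e.2} ↦ ℝ × ℝ) ⟨k, hk⟩)
    else (ContinuousLinearMap.snd ℝ ℝ ℝ).comp (ContinuousLinearMap.proj (R := ℝ)
        (φ := fun _ : {e : Fin N × Fin N // e.1 ≤ e.2} ↦ ℝ × ℝ) ⟨k.swap, (not_le.1 hk).le⟩)
  have hT : (fun ω (k : Fin N × Fin N) ↦ X ω k.1 k.2) =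
      fun ω ↦ T fun e ↦ (X ω e.1.1 e.1.2, X ω e.1.2 e.1.1) := by
    ext ω k
    by_cases hk : k.1 ≤ k.2 <;> simp [T, hk]
  rw [hT]
  exact h.map_fun T

/-- On the diagonal both indicators hold, which gives the prescribed variance `1 + γ`. -/
lemma IsRealGaussianElliptic.integral_mul (hX : IsRealGaussianElliptic γ X P)
    (k l : Fin N × Fin N) : ∫ ω, X ω k.1 k.2 * X ω l.1 l.2 ∂P =
      (if k = l then 1 else 0) + if k = l.swap then γ else 0 := by
  have hmeas (i j) : AEStronglyMeasurable (fun ω ↦ X ω i j) P :=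
    (hX.hasGaussianLaw.eval (i, j)).aemeasurable.aestronglyMeasurable
  by_cases h1 : k = l
  · subst h1
    by_cases h2 : k.1 = k.2
    · have h3 : k = k.swap := Prod.ext h2 h2.symm
      rw [if_pos rfl, if_pos h3, ← hX.sq_diag k.1, h2]
      simp only [sq]
    · have h3 : k ≠ k.swap := fun h ↦ h2 (congrArg Prod.fst h)
      rw [if_pos rfl, if_neg h3, add_zero, ← hX.sq_offDiag k.1 k.2 h2]
      simp only [sq]
  by_cases h2 : k = l.swap
  · have h3 : l.2 ≠ l.1 := fun h ↦ h1 (h2.trans (Prod.ext h h.symm))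
    rw [if_neg h1, if_pos h2, zero_add, h2]
    exact hX.mul_offDiag _ _ h3
  rw [if_neg h1, if_neg h2, add_zero]
  -- `s` selects the independent pair containing an entry and `f` its coordinate there; entries
  -- neither equal nor transposed lie in different pairs.
  let s (k : Fin N × Fin N) : {e : Fin N × Fin N // e.1 ≤ e.2} :=
    if hk : k.1 ≤ k.2 then ⟨k, hk⟩ else ⟨k.swap, (not_le.1 hk).le⟩
  let f (k : Fin N × Fin N) : ℝ × ℝ → ℝ := if k.1 ≤ k.2 then Prod.fst else Prod.snd
  have hf (k) : Measurable (f k) := by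
    by_cases hk : k.1 ≤ k.2
    · simpa [f, hk] using measurable_fst
    · simpa [f, hk] using measurable_snd
  have hs : s k ≠ s l := by
    intro h
    by_cases hk : k.1 ≤ k.2 <;> by_cases hl : l.1 ≤ l.2 <;> simp [s, hk, hl] at h
    · exact h1 h
    · exact h2 h
    · exact h2 (by rw [← h, Prod.swap_swap])
    · exact h1 h
  have hcomp (k : Fin N × Fin N) : (fun ω ↦ X ω k.1 k.2) =
      f k ∘ fun ω ↦ (X ω (s k).1.1 (s k).1.2, X ω (s k).1.2 (s k).1.1) := by
    ext ω
    by_cases hk : k.1 ≤ k.2 <;> simp [f, s, hk]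
  have hind : IndepFun (fun ω ↦ X ω k.1 k.2) (fun ω ↦ X ω l.1 l.2) P := by
    rw [hcomp k, hcomp l]
    exact (hX.indep.indepFun hs).comp (hf k) (hf l)
  rw [hind.integral_fun_mul_eq_mul_integral (hmeas _ _) (hmeas _ _), hX.centered, zero_mul]

end EllipticLaw

lemma hasGaussianLaw_id_stdGaussianPi (ι : Type*) [Fintype ι] :
    HasGaussianLaw (fun g : ι → ℝ ↦ g) (stdGaussianPi ι) := by
  refine iIndepFun.hasGaussianLaw (X := fun i (g : ι → ℝ) ↦ g i) (fun i ↦ ⟨?_⟩) ?_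
  · have : (stdGaussianPi ι).map (fun g ↦ g i) = gaussianReal 0 1 :=
      (measurePreserving_eval (fun _ : ι ↦ gaussianReal 0 1) i).map_eq
    rw [this]
    infer_instance
  · exact iIndepFun_pi (X := fun _ x ↦ x) fun i ↦ aemeasurable_id

/-- The entries of `a G + b Gᵀ`. -/
def ellipticCoords {N : ℕ} (a b : ℝ) (g : Fin N × Fin N → ℝ) (k : Fin N × Fin N) : ℝ :=
  a * g k + b * g k.swap

lemma hasGaussianLaw_ellipticCoords (a b : ℝ) (N : ℕ) :
    HasGaussianLaw (ellipticCoords (N := N) a b) (stdGaussianPi (Fin N × Fin N)) := by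
  let T : (Fin N × Fin N → ℝ) →L[ℝ] (Fin N × Fin N → ℝ) :=
    ContinuousLinearMap.pi fun k : Fin N × Fin N ↦
      a • ContinuousLinearMap.proj (R := ℝ) (φ := fun _ : Fin N × Fin N ↦ ℝ) k +
      b • ContinuousLinearMap.proj (R := ℝ) (φ := fun _ : Fin N × Fin N ↦ ℝ) k.swap
  have hT : ellipticCoords (N := N) a b = fun g ↦ T g := by
    ext g k
    simp [T, ellipticCoords]
  rw [hT]
  exact (hasGaussianLaw_id_stdGaussianPi (Fin N × Fin N)).map_fun T

lemma integral_ellipticCoords (a b : ℝ) {N : ℕ} (k : Fin N × Fin N) :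
    ∫ g, ellipticCoords a b g k ∂stdGaussianPi (Fin N × Fin N) = 0 := by
  have h := gaussianExp_apply (a • MvPolynomial.X k + b • MvPolynomial.X k.swap)
  have h1 (l : Fin N × Fin N) : gaussianExp (Fin N × Fin N) (MvPolynomial.X l) = 0 := by
    have := gaussianExp_X_mul l (1 : MvPolynomial (Fin N × Fin N) ℝ)
    simpa using this
  simpa [h1, ellipticCoords] using h.symm

lemma integral_ellipticCoords_mul (a b : ℝ) (hab : a ^ 2 + b ^ 2 = 1) {N : ℕ}
    (k l : Fin N × Fin N) :
    ∫ g, ellipticCoords a b g k * ellipticCoords a b g l ∂stdGaussianPi (Fin N × Fin N) =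
      (if k = l then 1 else 0) + if k = l.swap then 2 * a * b else 0 := by
  have h := gaussianExp_apply ((a • MvPolynomial.X k + b • MvPolynomial.X k.swap) *
    (a • MvPolynomial.X l + b • MvPolynomial.X l.swap))
  have h1 (k l : Fin N × Fin N) : gaussianExp (Fin N × Fin N)
      (MvPolynomial.X k * MvPolynomial.X l) = if k = l then 1 else 0 := by
    rw [gaussianExp_X_mul, MvPolynomial.pderiv_X, Pi.single_apply]
    by_cases h : k = l
    · simp [h, gaussianExp_one]
    · simp [h, Ne.symm h]
  have h2 : k.swap = l ↔ k = l.swap := by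
    rw [← Prod.swap_inj, Prod.swap_swap]
  have h3 : ∫ g, ellipticCoords a b g k * ellipticCoords a b g l
      ∂stdGaussianPi (Fin N × Fin N) = gaussianExp (Fin N × Fin N)
        ((a • MvPolynomial.X k + b • MvPolynomial.X k.swap) *
          (a • MvPolynomial.X l + b • MvPolynomial.X l.swap)) := by
    rw [h]
    simp [ellipticCoords]
  rw [h3]
  simp only [mul_add, add_mul, smul_mul_smul_comm, map_add, map_smul, h1, Prod.swap_inj, h2,
    smul_eq_mul]
  split_ifs
  · linear_combination hab
  · linear_combination hab
  · ring
  · ring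

/-- The product of copies of a real matrix and its transpose along a word. -/
def matrixWord {N : ℕ} (w : List (ZMod 2)) (A : Matrix (Fin N) (Fin N) ℝ) :
    Matrix (Fin N) (Fin N) ℝ :=
  (w.map fun ε ↦ if ε = 0 then A else Aᵀ).prod

/-- The normalized trace of a word as a function of the matrix entries. -/
noncomputable def wordTrace {N : ℕ} (w : List (ZMod 2)) (x : Fin N × Fin N → ℝ) : ℝ :=
  (matrixWord w (normalizedMatrix (.of fun i j ↦ x (i, j)))).trace

lemma continuous_wordTrace {N : ℕ} (w : List (ZMod 2)) : Continuous (wordTrace (N := N) w) := by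
  have hA : Continuous fun x : Fin N × Fin N → ℝ ↦
      normalizedMatrix (.of fun i j ↦ x (i, j) : Matrix (Fin N) (Fin N) ℝ) := by
    have : Continuous fun x : Fin N × Fin N → ℝ ↦
        (.of fun i j ↦ x (i, j) : Matrix (Fin N) (Fin N) ℝ) :=
      continuous_matrix fun i j ↦ continuous_apply (i, j)
    exact this.const_smul (√(N : ℝ))⁻¹
  refine Continuous.matrix_trace (continuous_list_prod _ fun ε _ ↦ ?_)
  split_ifs
  · exact hA
  · exact hA.matrix_transpose

lemma eval_tr_gaussianModel (a b : ℝ) (h : a ^ 2 + b ^ 2 = 1) {N : ℕ} (w : List (ZMod 2))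
    (g : Fin N × Fin N → ℝ) :
    MvPolynomial.eval g ((gaussianModel a b h N).tr w) = wordTrace w (ellipticCoords a b g) := by
  have hA (ε : ZMod 2) : (MvPolynomial.eval g).mapMatrix ((gaussianModel a b h N).A ε) =
      if ε = 0 then normalizedMatrix (.of fun i j ↦ ellipticCoords a b g (i, j))
      else (normalizedMatrix (.of fun i j ↦ ellipticCoords a b g (i, j)))ᵀ := by
    have h2 : ∀ x : ZMod 2, x = 0 ∨ x = 1 := by decide
    ext i j
    rcases h2 ε with rfl | rfl <;>
    simp [gaussianModel, entryIndex, normalizedMatrix, ellipticCoords,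
      show (1 + 1 : ZMod 2) = 0 from rfl, mul_add]
  have htr : MvPolynomial.eval g ((gaussianModel a b h N).tr w) =
      ((MvPolynomial.eval g).mapMatrix ((gaussianModel a b h N).word w)).trace := by
    simp [EllipticModel.tr, Matrix.trace]
  rw [htr, wordTrace, matrixWord, EllipticModel.word, map_list_prod, List.map_map]
  congr 2
  exact List.map_congr_left fun ε _ ↦ hA ε

/-! ### Transfer of trace covariances to the polynomial model -/

section Transfer

variable {Ω : Type*} [MeasurableSpace Ω] {N : ℕ} {X : Ω → Matrix (Fin N) (Fin N) ℝ}
  {P : Measure Ω} {a b : ℝ}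

lemma IsRealGaussianElliptic.map_eq (hX : IsRealGaussianElliptic (2 * a * b) X P)
    (h : a ^ 2 + b ^ 2 = 1) : P.map (fun ω (k : Fin N × Fin N) ↦ X ω k.1 k.2) =
      (stdGaussianPi (Fin N × Fin N)).map (ellipticCoords a b) :=
  map_eq_map_of_hasGaussianLaw hX.hasGaussianLaw (hasGaussianLaw_ellipticCoords a b N)
    (fun k ↦ hX.centered k.1 k.2) (integral_ellipticCoords a b)
    fun k l ↦ by rw [hX.integral_mul, integral_ellipticCoords_mul a b h]

lemma memLp_eval_stdGaussianPi {ι : Type*} [Fintype ι] (p : MvPolynomial ι ℝ) :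
    MemLp (fun g ↦ MvPolynomial.eval g p) 2 (stdGaussianPi ι) := by
  rw [memLp_two_iff_integrable_sq (integrable_eval_stdGaussianPi p).aestronglyMeasurable]
  have h : (fun g ↦ MvPolynomial.eval g p ^ 2) = fun g ↦ MvPolynomial.eval g (p ^ 2) := by
    ext g
    rw [map_pow]
  rw [h]
  exact integrable_eval_stdGaussianPi (p ^ 2)

lemma memLp_wordTrace_ellipticCoords (h : a ^ 2 + b ^ 2 = 1) (w : List (ZMod 2)) :
    MemLp (wordTrace w ∘ ellipticCoords (N := N) a b) 2 (stdGaussianPi (Fin N × Fin N)) := by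
  have := memLp_eval_stdGaussianPi ((gaussianModel a b h N).tr w)
  simp only [eval_tr_gaussianModel] at this
  exact this

lemma IsRealGaussianElliptic.memLp_trace (hX : IsRealGaussianElliptic (2 * a * b) X P)
    (h : a ^ 2 + b ^ 2 = 1) (w : List (ZMod 2)) :
    MemLp (fun ω ↦ (matrixWord w (normalizedMatrix (X ω))).trace) 2 P := by
  have h1 : MemLp (wordTrace w) 2 (P.map (fun ω (k : Fin N × Fin N) ↦ X ω k.1 k.2)) := by
    rw [hX.map_eq h, memLp_map_measure_iff (continuous_wordTrace w).aestronglyMeasurable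
      (hasGaussianLaw_ellipticCoords a b N).aemeasurable]
    exact memLp_wordTrace_ellipticCoords h w
  exact (memLp_map_measure_iff (continuous_wordTrace w).aestronglyMeasurable
    hX.hasGaussianLaw.aemeasurable).1 h1

lemma IsRealGaussianElliptic.covariance_trace (hX : IsRealGaussianElliptic (2 * a * b) X P)
    (h : a ^ 2 + b ^ 2 = 1) (w w' : List (ZMod 2)) :
    cov[fun ω ↦ (matrixWord w (normalizedMatrix (X ω))).trace,
      fun ω ↦ (matrixWord w' (normalizedMatrix (X ω))).trace; P] =
      (gaussianModel a b h N).moment [w, w'] := by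
  have hw (w) (μ : Measure (Fin N × Fin N → ℝ)) : AEStronglyMeasurable (wordTrace w) μ :=
    (continuous_wordTrace w).aestronglyMeasurable
  have h1 := covariance_map (hw w _) (hw w' _) hX.hasGaussianLaw.aemeasurable
  rw [hX.map_eq h, covariance_map (hw w _) (hw w' _)
    (hasGaussianLaw_ellipticCoords a b N).aemeasurable] at h1
  refine h1.symm.trans ?_
  rw [covariance_eq_sub (memLp_wordTrace_ellipticCoords h w)
    (memLp_wordTrace_ellipticCoords h w'), EllipticModel.moment_pair]
  have hE : (gaussianModel a b h N).E = gaussianExp (Fin N × Fin N) := rfl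
  simp only [hE, gaussianExp_apply, map_mul, eval_tr_gaussianModel]
  rfl

end Transfer

/-! ### Identification of the limits and conclusion -/

lemma matrixWord_progWord_zero {N : ℕ} (A : Matrix (Fin N) (Fin N) ℝ) (p : ℕ) :
    matrixWord (progWord 0 0 p) A = A ^ p := by
  induction p with
  | zero => rfl
  | succ p ih =>
    rw [pow_succ', ← ih]
    simp [matrixWord, progWord]

lemma matrixWord_progWord_one {N : ℕ} (A : Matrix (Fin N) (Fin N) ℝ) (p : ℕ) :
    matrixWord (progWord 1 0 (2 * p)) A = (A * Aᵀ) ^ p := by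
  induction p with
  | zero => rfl
  | succ p ih =>
    rw [pow_succ', ← ih]
    simp [matrixWord, progWord, mul_add, show (1 + 1 : ZMod 2) = 0 from rfl, mul_assoc]

lemma limitCov_eq_purePowerLimit (γ : ℝ) (p q : ℕ) :
    limitCov γ 1 p q = purePowerLimit γ p q := by
  have hterm (t : ℕ) : ((t : ℝ) + 1) * (γ ^ (t + 1) + 1 ^ (t + 1)) *
      (folded γ p (t + 1) * folded γ q (t + 1)) =
      if t + 1 ≤ min p q ∧ Even (p - (t + 1)) ∧ Even (q - (t + 1)) then
        ((t + 1 : ℕ) : ℝ) * γ ^ ((p + q) / 2 - (t + 1)) * (γ ^ (t + 1) + 1) *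
        (p.choose ((p - (t + 1)) / 2) : ℝ) * (q.choose ((q - (t + 1)) / 2) : ℝ) else 0 := by
    split_ifs with h
    · obtain ⟨h1, ⟨k, hk⟩, ⟨l, hl⟩⟩ := h
      have h2 : t + 1 ≤ p := h1.trans (min_le_left _ _)
      have h3 : t + 1 ≤ q := h1.trans (min_le_right _ _)
      rw [folded_eq_choose γ p (t + 1) k (by omega), folded_eq_choose γ q (t + 1) l (by omega),
        show (p + q) / 2 - (t + 1) = k + l by omega, show (p - (t + 1)) / 2 = k by omega,
        show (q - (t + 1)) / 2 = l by omega, pow_add]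
      push_cast
      ring
    · have h0 : folded γ p (t + 1) = 0 ∨ folded γ q (t + 1) = 0 := by
        by_contra! hne
        have key (n : ℕ) (hn : folded γ n (t + 1) ≠ 0) : t + 1 ≤ n ∧ Even (n - (t + 1)) := by
          have h1 : t + 1 ≤ n := not_lt.1 fun hlt ↦ hn (folded_of_lt γ n _ hlt)
          have h2 : ¬ Odd (n + (t + 1)) := fun ho ↦ hn (folded_of_odd γ n _ ho)
          refine ⟨h1, ?_⟩
          rw [Nat.not_odd_iff_even, Nat.even_iff] at h2
          rw [Nat.even_iff]
          omega
        exact h ⟨le_min (key p hne.1).1 (key q hne.2).1, (key p hne.1).2, (key q hne.2).2⟩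
      rcases h0 with h0 | h0 <;> simp [h0]
  rw [limitCov, Finset.sum_congr rfl fun t _ ↦ hterm t, purePowerLimit, ← Finset.sum_filter]
  refine Finset.sum_bij (fun t _ ↦ t + 1) ?_ ?_ ?_ ?_
  · intro t ht
    simp only [Finset.mem_filter, Finset.mem_range, Finset.mem_Icc] at ht ⊢
    exact ⟨⟨by omega, ht.2.1⟩, ht.2.2⟩
  · intro s _ t _ h
    omega
  · intro s hs
    simp only [Finset.mem_filter, Finset.mem_Icc] at hs
    have := min_le_right p q
    refine ⟨s - 1, ?_, by omega⟩
    simp only [Finset.mem_filter, Finset.mem_range, show s - 1 + 1 = s by omega]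
    exact ⟨by omega, hs.1.2, hs.2⟩
  · intro t _
    rfl

lemma limitCov_eq_alternatingLimit (γ : ℝ) (p q : ℕ) :
    limitCov 1 γ (2 * p) (2 * q) = alternatingLimit γ p q := by
  -- Both lengths are even, so only `t + 1 = 2 * a` contributes.
  have hodd (t : ℕ) (ht : Even t) : folded 1 (2 * p) (t + 1) = 0 :=
    folded_of_odd 1 _ _ (by rw [Nat.even_iff] at ht; rw [Nat.odd_iff]; omega)
  rw [limitCov, alternatingLimit]
  rw [← Finset.sum_subset (s₁ := (Finset.Icc 1 (min p q)).image fun a ↦ 2 * a - 1)]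
  · rw [Finset.sum_image]
    · refine Finset.sum_congr rfl fun a ha ↦ ?_
      rw [Finset.mem_Icc, le_min_iff] at ha
      rw [show 2 * a - 1 + 1 = 2 * a by omega,
        folded_eq_choose 1 (2 * p) (2 * a) (p - a) (by omega),
        folded_eq_choose 1 (2 * q) (2 * a) (q - a) (by omega), Nat.cast_sub (by omega)]
      push_cast
      ring
    · intro s hs t ht h
      simp only [Finset.coe_Icc, Set.mem_Icc] at hs ht h
      omega
  · intro t ht
    simp only [Finset.mem_image, Finset.mem_Icc, le_min_iff] at ht
    obtain ⟨s, hs, rfl⟩ := ht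
    rw [Finset.mem_range]
    omega
  · intro t ht ht'
    rcases Nat.even_or_odd t with he | ⟨s, rfl⟩
    · rw [hodd t he]
      simp
    · have h1 : 2 * p < 2 * s + 1 + 1 := by
        by_contra hcon
        refine ht' (Finset.mem_image.2 ⟨s + 1, ?_, by omega⟩)
        rw [Finset.mem_range] at ht
        rw [Finset.mem_Icc, le_min_iff]
        omega
      rw [folded_of_lt 1 _ _ h1]
      simp

lemma exists_sq_add_sq_eq_one {γ : ℝ} (hγ : γ ∈ Set.Icc (-1 : ℝ) 1) :
    ∃ a b : ℝ, a ^ 2 + b ^ 2 = 1 ∧ 2 * a * b = γ := by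
  have h1 := Real.sq_sqrt (show 0 ≤ 1 + γ by linarith [hγ.1])
  have h2 := Real.sq_sqrt (show 0 ≤ 1 - γ by linarith [hγ.2])
  -- Solves `a + b = √(1 + γ)` and `a - b = √(1 - γ)`, the weights of the symmetric and
  -- antisymmetric parts of `G`.
  refine ⟨(√(1 + γ) + √(1 - γ)) / 2, (√(1 + γ) - √(1 - γ)) / 2, ?_, ?_⟩
  · linear_combination h1 / 2 + h2 / 2
  · linear_combination h1 / 2 - h2 / 2

/-- The traces of two words of the same type have the limit covariance `limitCov`. -/
lemma hasLimitCovariance_matrixWord {Ω : ℕ → Type*} [∀ N, MeasurableSpace (Ω N)]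
    (P : ∀ N, Measure (Ω N)) {a b : ℝ} (h : a ^ 2 + b ^ 2 = 1)
    (X : ∀ N, Ω N → Matrix (Fin N) (Fin N) ℝ)
    (hX : ∀ N, IsRealGaussianElliptic (2 * a * b) (X N) (P N)) (δ : ZMod 2) (p q : ℕ)
    (hp : (p : ZMod 2) * δ = 0) (hq : (q : ZMod 2) * δ = 0) (hq1 : 1 ≤ q) :
    HasLimitCovariance P
      (fun N ω ↦ (matrixWord (progWord δ 0 p) (normalizedMatrix (X N ω))).trace)
      (fun N ω ↦ (matrixWord (progWord δ 0 q) (normalizedMatrix (X N ω))).trace)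
      (limitCov (pairWeight (2 * a * b) δ) (pairWeight (2 * a * b) (δ + 1)) p q) := by
  refine ⟨fun N ↦ (hX N).memLp_trace h _, fun N ↦ (hX N).memLp_trace h _, ?_⟩
  simp only [fun N ↦ (hX N).covariance_trace h]
  obtain ⟨q, rfl⟩ := Nat.exists_eq_add_of_le' hq1
  exact EllipticModel.tendsto_moment_progWord (fun N ↦ gaussianModel a b h N) δ 0 0 p q hp hq

theorem theorem1p5 {Ω : ℕ → Type*} [∀ N, MeasurableSpace (Ω N)]
    (P : ∀ N, Measure (Ω N)) [∀ N, IsProbabilityMeasure (P N)]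
    (γ : ℝ) (hγ : γ ∈ Set.Icc (-1 : ℝ) 1)
    (X : ∀ N, Ω N → Matrix (Fin N) (Fin N) ℝ)
    (hX : ∀ N, IsRealGaussianElliptic γ (X N) (P N))
    (p q : ℕ) (hp : 1 ≤ p) (hq : 1 ≤ q) :
    HasLimitCovariance P
      (fun N ω ↦ (normalizedMatrix (X N ω) ^ p).trace)
      (fun N ω ↦ (normalizedMatrix (X N ω) ^ q).trace)
      (purePowerLimit γ p q) ∧
    HasLimitCovariance P
      (fun N ω ↦ (normalizedMatrix (X N ω) ^ p).trace)
      (fun N ω ↦ ((normalizedMatrix (X N ω))ᵀ ^ q).trace)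
      (purePowerLimit γ p q) ∧
    HasLimitCovariance P
      (fun N ω ↦ ((normalizedMatrix (X N ω) * (normalizedMatrix (X N ω))ᵀ) ^ p).trace)
      (fun N ω ↦ ((normalizedMatrix (X N ω) * (normalizedMatrix (X N ω))ᵀ) ^ q).trace)
      (alternatingLimit γ p q) := by
  obtain ⟨a, b, h, rfl⟩ := exists_sq_add_sq_eq_one hγ
  have h2 : (2 : ZMod 2) = 0 := rfl
  have hpure := hasLimitCovariance_matrixWord P h X hX 0 p q (mul_zero _) (mul_zero _) hq
  have halt := hasLimitCovariance_matrixWord P h X hX 1 (2 * p) (2 * q)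
    (by push_cast; rw [h2]; simp) (by push_cast; rw [h2]; simp) (by omega)
  simp only [matrixWord_progWord_zero, zero_add] at hpure
  simp only [matrixWord_progWord_one, show (1 + 1 : ZMod 2) = 0 from rfl] at halt
  rw [show pairWeight (2 * a * b) 0 = 2 * a * b from if_pos rfl,
    show pairWeight (2 * a * b) 1 = 1 from if_neg (by decide)] at hpure halt
  rw [limitCov_eq_purePowerLimit] at hpure
  rw [limitCov_eq_alternatingLimit] at halt
  refine ⟨hpure, ?_, halt⟩
  -- A matrix and its transpose have the same trace, so the second covariance is literally the
  -- first.
  simpa only [← Matrix.transpose_pow, Matrix.trace_transpose] using hpure
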